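/- **Setting.** Fix $\lambda_2,R_L,C_2,P_2,G_0,d,\lambda>0$ (with $G_0=1$ in the standard normalisation), $\alpha:=\alpha_2\ge 2$, integers $N_2\ge 1$ (antennas) and $N:=N_2^p\ge 1$ (Nakagami parameter), and $p:=p_{2,f}\in[0,1]$. Pico base stations that do (do not) cache the $f$-th file form independent planar Poisson processes of density $p\lambda_2$ (resp. $(1-p)\lambda_2$); each station carries independent marks: an angle $\omega$ uniform on $[-d/\lambda,d/\lambda]$ and a fading power $|h|^2\sim\mathrm{Gamma}(N,N)$ (mean $1$). The path loss is $L_2(r)=C_2r^{-\alpha}$ for $r\le R_L$ and $0$ for $r>R_L$; the array gain is $G_2(\omega)=\frac{\sin^2(\pi N_2\omega)}{N_2^2\sin^2(\pi\omega)}$ (with limit value $1$ where $\sin\pi\omega=0$). The nearest station caching the file, at distance $r$ with density $P_{2,f}(r)=2\pi p\lambda_2 r e^{-\pi p\lambda_2r^2}$, serves the typical user at the origin, and the interference $I_r=\sum P_2L_2(\|x\|)N_2|h|^2G_2(\omega)$ runs over the caching stations with $\|x\|>r$ and over all non-caching stations. Noise is neglected. Put $\eta_L=N(N!)^{-1/N}$,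 and replace the tail $\mathbb P[|h|^2>\gamma]$ of the serving link by $1-(1-e^{-\eta_L\gamma})^N$. The resulting cache-related coverage probability is $$P_{\Upsilon_{2,f}}(\tau)=\int_0^{R_L}\mathbb E\Big[1-\Big(1-\exp\Big(-\eta_L\frac{\tau I_r}{P_2L_2(r)G_0N_2}\Big)\Big)^{N}\Big]P_{2,f}(r)\,dr ,$$ and $p_{\Upsilon_{2,f}}=-\frac{d}{d\tau}P_{\Upsilon_{2,f}}$ is its PDF. **Notation.** For an order $u\ge1$ let $x^{(u)}_k=\cos\frac{(2k-1)\pi}{2u}$, $1\le k\le u$. Let $S^k(z)={}_2F_1(k-\frac2\alpha,k+N;k+1-\frac2\alpha;-z)$, $\Delta(z)=\Gamma(1-\frac2\alpha)\Gamma(N+\frac2\alpha)\Gamma(N)^{-1}z^{2/\alpha}$, $\Lambda(z)=\Delta'(z)=\frac2\alpha\Gamma(1-\frac2\alpha)\Gamma(N+\frac2\alpha)\Gamma(N)^{-1}z^{2/\alpha-1}$ and $$F_y(y)=N\ln\Big(1+\frac1y\Big)-\frac1{y(1+y)^{N-1}}-\sum_{m=1}^{N-1}\frac{N}{(1+y)^{N-m}(N-m)}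 .$$ At serving distance $r$ put $X=sG_2(\omega)\tau/N$, and $$W_f(\omega,s,\tau)=p\,S^0\Big(\frac{X}{r^\alpha}\Big)r^2+(1-p)\Delta(X)-S^0\Big(\frac{X}{R_L^\alpha}\Big)R_L^2\quad(\alpha>2),$$ $$W_f(\omega,s,\tau)=X\Big(F_y\Big(\frac{X}{R_L^2}\Big)-p\,F_y\Big(\frac{X}{r^2}\Big)\Big)\quad(\alpha=2),$$ the last expression being read as its limit $p\,r^2-R_L^2$ where $X=0$. Let $$\mathcal L_2^{(u)}(s,\tau)=\exp\Big(-\pi\lambda_2(R_L^2-p\,r^2)-\frac{\pi^2\lambda_2}{2u}\sum_{k=1}^{u}W_f\Big(\frac{x^{(u)}_kd}{\lambda},s,\tau\Big)\sqrt{1-(x_k^{(u)})^2}\Big),$$ $$F_D^{(u)}(r,\tau)=\mathcal L_2^{(u)}\Big(\frac{n\eta_Lr^\alpha}{G_0},\tau\Big)P_{2,f}(r).$$ The Gauss–Chebyshev form of the coverage probability is $$P^{(u,v)}(\tau)=\frac{\pi R_L}{2v}\sum_{n=1}^{N}(-1)^{n+1}\binom Nn\sum_{k=1}^{v}F_D^{(u)}\Big(\frac{(x^{(v)}_k+1)R_L}{2},\tau\Big)\sqrt{1-(x^{(v)}_k)^2}.$$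 Let $Z(\omega)=\frac{n\eta_LG_2(\omega)}{G_0N}$ and let $w_f$ be the closed form of the $\tau$-derivative of $W_f$ at $s=n\eta_Lr^\alpha/G_0$: for $\alpha>2$ $$w_f(\omega,r,\tau)=\frac{2NZ(\omega)}{\alpha-2}\Big(p\,S^1(Z(\omega)\tau)r^2-S^1\Big(\frac{Z(\omega)\tau r^\alpha}{R_L^\alpha}\Big)\frac{r^\alpha}{R_L^{\alpha-2}}\Big)+(1-p)Z(\omega)\Lambda(Z(\omega)\tau)r^2$$ (with value $0$ where $Z(\omega)=0$), and for $\alpha=2$ $$w_f(\omega,r,\tau)=Z(\omega)r^2\Big(f_y\Big(\frac{Z(\omega)\tau r^2}{R_L^2},r\Big)-p\,f_y(Z(\omega)\tau,R_L)\Big)$$ (again $0$ where $Z(\omega)=0$), where $$f_y(y,z)=F_y(y)+Z(\omega)\tau\frac{z^2}{R_L^2}\Big(\frac{Ny+1}{y^2(1+y)^N}-\frac{N}{y(1+y)}+\sum_{m=1}^{N-1}\frac{N}{(1+y)^{N-m+1}}\Big).$$ Finally put $$f_D^{(u_1,u_2)}(r,\tau)=\frac{\pi^2\lambda_2F_D^{(u_1)}(r,\tau)}{2u_2}\sum_{k=1}^{u_2}w_f\Big(\frac{x^{(u_2)}_kd}{\lambda},r,\tau\Big)\sqrt{1-(x^{(u_2)}_k)^2},$$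 $$p^{(u_1,u_2,u_3)}(\tau)=\frac{\pi R_L}{2u_3}\sum_{n=1}^{N}(-1)^{n+1}\binom Nn\sum_{k=1}^{u_3}f_D^{(u_1,u_2)}\Big(\frac{R_L(x^{(u_3)}_k+1)}{2},\tau\Big)\sqrt{1-(x^{(u_3)}_k)^2}.$$ **Statement.** Let $\tau>0$. 1. For all $u,v\ge1$, $P^{(u,v)}$ is differentiable at $\tau$ and $-\frac{d}{d\tau}P^{(u,v)}(\tau)=p^{(u,u,v)}(\tau)$ exactly. 2. $P_{\Upsilon_{2,f}}$ is differentiable at $\tau$, and as $u_1,u_2,u_3\to\infty$ (jointly, in any manner) $P^{(u_1,u_3)}(\tau)\to P_{\Upsilon_{2,f}}(\tau)$ and $p^{(u_1,u_2,u_3)}(\tau)\to p_{\Upsilon_{2,f}}(\tau)=-\frac{d}{d\tau}P_{\Upsilon_{2,f}}(\tau)$. -/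

import Mathlib

open MeasureTheory ProbabilityTheory Filter Topology
open scoped ENNReal

noncomputable section

namespace CacheHetNet

/-- Parameters of the pico (second) tier, for one fixed requested file. -/
structure PicoTier where
  /-- density of the pico base stations -/
  density : ℝ
  /-- probability that a pico base station caches the requested file -/
  cacheProb : ℝ
  /-- radius of the line-of-sight ball -/
  R : ℝ
  /-- path loss exponent of line-of-sight links -/
  α : ℝ
  /-- path loss intercept -/
  C : ℝ
  /-- transmit power -/
  power : ℝ
  /-- maximum directivity gain (normalised to `1` in the standard model) -/
  G₀ : ℝ
  /-- number of antenna elements -/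
  ants : ℕ
  /-- Nakagami fading parameter, a positive integer -/
  N : ℕ
  /-- antenna spacing -/
  d : ℝ
  /-- wavelength -/
  wavelength : ℝ
  density_pos : 0 < density
  cacheProb_nonneg : 0 ≤ cacheProb
  cacheProb_le_one : cacheProb ≤ 1
  R_pos : 0 < R
  two_le_α : 2 ≤ α
  C_pos : 0 < C
  power_pos : 0 < power
  G₀_pos : 0 < G₀
  ants_pos : 0 < ants
  N_pos : 0 < N
  d_pos : 0 < d
  wavelength_pos : 0 < wavelength

/-- `Φ` is a Poisson point process (a random counting measure) on `E` with intensity `Λ`. -/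
structure IsPoissonProcess {Ω E : Type*} [MeasurableSpace Ω] [MeasurableSpace E]
    (Φ : Ω → Measure E) (Λ : Measure E) (μ : Measure Ω) : Prop where
  measurable : Measurable Φ
  law : ∀ B : Set E, MeasurableSet B → Λ B ≠ ∞ →
    μ.map (fun ω => Φ ω B) = (poissonMeasure (Λ B).toNNReal).map (fun k : ℕ => (k : ℝ≥0∞))
  indep : ∀ (k : ℕ) (B : Fin k → Set E), (∀ i, MeasurableSet (B i)) →
    Pairwise (fun i j => Disjoint (B i) (B j)) →
    iIndepFun (fun i ω => Φ ω (B i)) μ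

/-- A base station with its marks: the location (the typical user is at the origin), the angle
variable in the array gain, and the fading power `|h|²`. -/
abbrev MarkedBS : Type := EuclideanSpace ℝ (Fin 2) × ℝ × ℝ

/-- `k`-th Gauss-Chebyshev node of order `u`, `1 ≤ k ≤ u`. -/
def chebNode (u k : ℕ) : ℝ := Real.cos ((2 * (k : ℝ) - 1) / (2 * (u : ℝ)) * Real.pi)

/-- The Gauss hypergeometric function `₂F₁(a, b; c; -x)` for `x ≥ 0`. For `x ≥ 1` the power series
diverges and the analytic continuation to the half-line is meant; it is given on the whole of
`x ≥ 0` by Pfaff's transformation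
`₂F₁(a, b; c; -x) = (1 + x)^(-b) ₂F₁(c - a, b; c; x / (1 + x))`, where `0 ≤ x / (1 + x) < 1`. -/
def hypNeg (a b c x : ℝ) : ℝ :=
  (1 + x) ^ (-b) * ordinaryHypergeometric (c - a) b c (x / (1 + x))

namespace PicoTier

variable (T : PicoTier)

/-! ### The stochastic model -/

/-- Path loss with line-of-sight ball. -/
def pathLoss (r : ℝ) : ℝ := if r ≤ T.R then T.C * r ^ (-T.α) else 0

/-- Array gain of the uniform linear array; at the (removable) zeros of the denominator it has its
limit value `1`. -/
def gain (ω : ℝ) : ℝ :=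
  if Real.sin (Real.pi * ω) = 0 then 1
  else Real.sin (Real.pi * T.ants * ω) ^ 2 / ((T.ants : ℝ) ^ 2 * Real.sin (Real.pi * ω) ^ 2)

/-- Intensity of an independently marked planar homogeneous Poisson process with density `ρ`: the
angle variable is uniform on `[-d/λ, d/λ]`, the fading power is a normalised Gamma variable with
parameter `N`. -/
def markedIntensity (ρ : ℝ) : Measure MarkedBS :=
  (ENNReal.ofReal ρ • (volume : Measure (EuclideanSpace ℝ (Fin 2)))).prod
    ((cond volume (Set.Icc (-(T.d / T.wavelength)) (T.d / T.wavelength))).prod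
      (gammaMeasure T.N T.N))

/-- Power received at the origin from an interfering base station. -/
def rxPower (x : MarkedBS) : ℝ :=
  T.power * T.pathLoss ‖x.1‖ * (T.ants * x.2.2 * T.gain x.2.1)

/-- Interference when the serving base station, which is the nearest one caching the file, is at
distance `r`: the other base stations caching the file (from `Φ`) lie farther than `r`, those not
caching it (from `Φ'`) are anywhere. -/
def interference (r : ℝ) (Φ Φ' : Measure MarkedBS) : ℝ :=
  (∫⁻ x in {x | r < ‖x.1‖}, ENNReal.ofReal (T.rxPower x) ∂Φ
    + ∫⁻ x, ENNReal.ofReal (T.rxPower x) ∂Φ').toReal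

/-- Density of the distance from the typical user to the nearest base station caching the file. -/
def distPDF (r : ℝ) : ℝ :=
  2 * Real.pi * T.cacheProb * T.density * r *
    Real.exp (-(Real.pi * T.cacheProb * T.density * r ^ 2))

/-- `η = N (N!)^(-1/N)`. -/
def eta : ℝ := T.N * (Nat.factorial T.N : ℝ) ^ (-(1 / (T.N : ℝ)))

/-- The approximation `1 - (1 - exp (-η γ))^N` of the tail `ℙ[|h|² > γ]` of the normalised Gamma
fading power of the serving link. -/
def fadingTail (γ : ℝ) : ℝ := 1 - (1 - Real.exp (-(T.eta * γ))) ^ T.N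

/-- Fading power of the serving link above which the signal-to-interference ratio exceeds `τ`, for
serving distance `r` and interference `I`. -/
def fadingThreshold (τ r I : ℝ) : ℝ :=
  τ * I / (T.power * T.pathLoss r * T.G₀ * T.ants)

/-- Interference-limited cache-related coverage probability at threshold `τ` (with the fading tail
`fadingTail`): average of the conditional coverage probability over the interfering point processes
`Φ`, `Φ'` and over the serving distance. -/
def coverage {Ω : Type*} [MeasurableSpace Ω] (μ : Measure Ω) (Φ Φ' : Ω → Measure MarkedBS)
    (τ : ℝ) : ℝ :=
  ∫ r in (0 : ℝ)..T.R,
    (∫ ω, T.fadingTail (T.fadingThreshold τ r (T.interference r (Φ ω) (Φ' ω))) ∂μ) * T.distPDF r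

/-! ### Laplace transform of the interference and the coverage probability by quadrature -/

/-- `S^k(z) = ₂F₁(k - 2/α, k + N; k + 1 - 2/α; -z)`. -/
def S (k : ℕ) (z : ℝ) : ℝ := hypNeg (k - 2 / T.α) (k + T.N) (k + 1 - 2 / T.α) z

/-- `Δ(z) = Γ(1 - 2/α) Γ(N + 2/α) Γ(N)⁻¹ z^(2/α)`. -/
def Delta (z : ℝ) : ℝ :=
  Real.Gamma (1 - 2 / T.α) * Real.Gamma (T.N + 2 / T.α) * (Real.Gamma T.N)⁻¹ * z ^ (2 / T.α)

/-- `Λ(z) = (2/α) Γ(1 - 2/α) Γ(N + 2/α) Γ(N)⁻¹ z^(2/α - 1)`. -/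
def Lam (z : ℝ) : ℝ :=
  2 / T.α * Real.Gamma (1 - 2 / T.α) * Real.Gamma (T.N + 2 / T.α) * (Real.Gamma T.N)⁻¹ *
    z ^ (2 / T.α - 1)

/-- `F_y(y)`, used for `α = 2`. -/
def Fy (y : ℝ) : ℝ :=
  T.N * Real.log (1 + 1 / y) - 1 / (y * (1 + y) ^ (T.N - 1))
    - ∑ m ∈ Finset.Icc 1 (T.N - 1), (T.N : ℝ) / ((1 + y) ^ (T.N - m) * ((T.N : ℝ) - m))

/-- `W_f(ω, s, τ)` at serving distance `r`. For `α = 2` the expression has a removable singularity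
where the array gain vanishes; there it has its limit value. -/
def W (r ω s τ : ℝ) : ℝ :=
  if T.α = 2 then
    if s * T.gain ω * τ / T.N = 0 then T.cacheProb * r ^ 2 - T.R ^ 2
    else s * T.gain ω * τ / T.N *
      (T.Fy (s * T.gain ω * τ / (T.N * T.R ^ 2))
        - T.cacheProb * T.Fy (s * T.gain ω * τ / (T.N * r ^ 2)))
  else
    T.cacheProb * T.S 0 (s * T.gain ω * τ / (T.N * r ^ T.α)) * r ^ 2
      + (1 - T.cacheProb) * T.Delta (s * T.gain ω * τ / T.N)
      - T.S 0 (s * T.gain ω * τ / (T.N * T.R ^ T.α)) * T.R ^ 2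

/-- Laplace transform `𝓛₂(s, τ)` of the interference at serving distance `r`, by Gauss-Chebyshev
quadrature of order `u`. -/
def laplaceGC (u : ℕ) (r s τ : ℝ) : ℝ :=
  Real.exp (-(Real.pi * T.density * (T.R ^ 2 - T.cacheProb * r ^ 2))
    - Real.pi ^ 2 * T.density / (2 * u) *
      ∑ k ∈ Finset.Icc 1 u, T.W r (chebNode u k * T.d / T.wavelength) s τ *
        Real.sqrt (1 - chebNode u k ^ 2))

/-- `F_D(r, τ)` for the summation index `n`. -/
def FD (u n : ℕ) (r τ : ℝ) : ℝ :=
  T.laplaceGC u r (n * T.eta * r ^ T.α / T.G₀) τ * T.distPDF r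

/-- Coverage probability as a Gauss-Chebyshev sum: inner order `u₁`, outer order `u₂`. -/
def coverageGC (u₁ u₂ : ℕ) (τ : ℝ) : ℝ :=
  Real.pi * T.R / (2 * u₂) *
    ∑ n ∈ Finset.Icc 1 T.N, (-1) ^ (n + 1) * (T.N.choose n : ℝ) *
      ∑ k ∈ Finset.Icc 1 u₂, T.FD u₁ n ((chebNode u₂ k + 1) * T.R / 2) τ *
        Real.sqrt (1 - chebNode u₂ k ^ 2)

/-! ### The derivative of the coverage probability by quadrature -/

/-- `Z(ω) = n η G(ω) / (G₀ N)`. -/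
def Z (n : ℕ) (ω : ℝ) : ℝ := n * T.eta * T.gain ω / (T.G₀ * T.N)

/-- `f_y(y, z)`, with the value `q = Z(ω) τ`. -/
def fy (q y z : ℝ) : ℝ :=
  T.Fy y + q * (z ^ 2 / T.R ^ 2) *
    ((T.N * y + 1) / (y ^ 2 * (1 + y) ^ T.N) - T.N / (y * (1 + y))
      + ∑ m ∈ Finset.Icc 1 (T.N - 1), (T.N : ℝ) / (1 + y) ^ (T.N - m + 1))

/-- `w_f(ω, r, τ)`, the closed form of the `τ`-derivative of `W_f` at `s = n η r^α / G₀`. -/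
def w (n : ℕ) (ω r τ : ℝ) : ℝ :=
  if T.α = 2 then
    T.Z n ω * r ^ 2 *
      (T.fy (T.Z n ω * τ) (T.Z n ω * τ * r ^ 2 / T.R ^ 2) r
        - T.cacheProb * T.fy (T.Z n ω * τ) (T.Z n ω * τ) T.R)
  else
    2 * T.N * T.Z n ω / (T.α - 2) *
      (T.cacheProb * T.S 1 (T.Z n ω * τ) * r ^ 2
        - T.S 1 (T.Z n ω * τ * r ^ T.α / T.R ^ T.α) * (r ^ T.α / T.R ^ (T.α - 2)))
      + (1 - T.cacheProb) * T.Z n ω * T.Lam (T.Z n ω * τ) * r ^ 2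

/-- `f_D(r, τ)` for the summation index `n`: order `u₁` inside `F_D`, order `u₂` for the sum
of `w_f`. -/
def fD (u₁ u₂ n : ℕ) (r τ : ℝ) : ℝ :=
  Real.pi ^ 2 * T.density * T.FD u₁ n r τ / (2 * u₂) *
    ∑ k ∈ Finset.Icc 1 u₂, T.w n (chebNode u₂ k * T.d / T.wavelength) r τ *
      Real.sqrt (1 - chebNode u₂ k ^ 2)

/-- The Gauss-Chebyshev double sum for the density of the coverage probability, with orders
`u₁` (inside `F_D`), `u₂` (sum of `w_f`) and `u₃` (outer sum). -/
def pdfGC (u₁ u₂ u₃ : ℕ) (τ : ℝ) : ℝ :=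
  Real.pi * T.R / (2 * u₃) *
    ∑ n ∈ Finset.Icc 1 T.N, (-1) ^ (n + 1) * (T.N.choose n : ℝ) *
      ∑ k ∈ Finset.Icc 1 u₃, T.fD u₁ u₂ n (T.R * (chebNode u₃ k + 1) / 2) τ *
        Real.sqrt (1 - chebNode u₃ k ^ 2)

end PicoTier

end CacheHetNet

end

noncomputable section

/-! Expanding the fading tail by the binomial theorem (`fadingTail_eq`) turns the coverage
probability into a finite combination of Laplace transforms of the interference. The Laplace
functional of two independent Poisson processes, averaged over the Gamma fading and integrated in
polar coordinates, expresses each of them through the single kernel K(y) = -2 ∫₀¹ (1 + y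
v^(-α))^(-N) v dv, averaged over the angle (`laplace_interference`).

The special functions enter only through three facts about K = `discKernel`: K(0) = -1, y K'(y) =
(2/α)(K(y) + (1 + y)^(-N)) for y > 0, and y^(-2/α) K(y) → 0 at infinity. For X > 0 the last two say
that v²/2 · (1 + K(X v^(-α))) is the antiderivative of the radial integrand v (1 - (1 + X
v^(-α))^(-N)) that vanishes at v = 0 (`integral_disc`). Both Δ - S⁰ (α > 2) and y F_y(y) (α = 2)
have these properties, so the two cases merge from there on. At s = n η r^α / G₀, W_f and t · w_f
are combinations of values of K and of y K'(y) (`W_eq`, `w_eq`), and these combinations are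
continuous in (r, ω, t) even at r = 0, at t = 0 and at zeros of the array gain.

The first claim holds because w_f is the exact derivative of W_f at every node and all sums are
finite (`hasDerivAt_coverageGC`). For the second, the substitution x = cos θ makes a Gauss-Chebyshev
sum a midpoint rule, which converges for continuous integrands, also when the integrand itself
varies along the filter and converges continuously (`tendsto_chebQuad`). The inner sums converge
jointly in their order and in the serving distance, so the nested sums converge with no relation
between the three orders. Differentiating the exact integrals under the integral sign
(`hasDerivAt_coverageTerm`) identifies the limit of the densities with the derivative of the limit.
-/

namespace CacheHetNet

/-! ### The hypergeometric function `₂F₁(1, b; c; x)` -/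

/-- Ratio of rising factorials `(b)_k / (c)_k`. -/
def pochRatio (b c : ℝ) (k : ℕ) : ℝ :=
  (ascPochhammer ℝ k).eval b / (ascPochhammer ℝ k).eval c

lemma pochRatio_zero (b c : ℝ) : pochRatio b c 0 = 1 := by simp [pochRatio]

lemma pochRatio_pos {b c : ℝ} (hb : 0 < b) (hc : 0 < c) (k : ℕ) : 0 < pochRatio b c k :=
  div_pos (ascPochhammer_pos k b hb) (ascPochhammer_pos k c hc)

lemma pochRatio_succ {b c : ℝ} (hc : 0 < c) (k : ℕ) :
    pochRatio b c (k + 1) * (c + k) = pochRatio b c k * (b + k) := by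
  have h1 := (ascPochhammer_pos k c hc).ne'
  have h2 : c + k ≠ 0 := by positivity
  simp only [pochRatio, ascPochhammer_succ_eval]
  field_simp

lemma pochRatio_succ_left {b c : ℝ} (hc : 0 < c) (k : ℕ) :
    pochRatio b c (k + 1) = b / c * pochRatio (b + 1) (c + 1) k := by
  have h1 := (ascPochhammer_pos k (c + 1) (by linarith)).ne'
  simp only [pochRatio, ascPochhammer_succ_left, Polynomial.eval_mul, Polynomial.eval_X,
    Polynomial.eval_comp, Polynomial.eval_add, Polynomial.eval_one]
  field_simp

/-- Since (1)_k = k!, the factorial in the series cancels and only (b)_k / (c)_k is left. -/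
lemma hypergeometric_one_eq_tsum (b c x : ℝ) :
    ordinaryHypergeometric 1 b c x = ∑' k : ℕ, pochRatio b c k * x ^ k := by
  rw [ordinaryHypergeometric_eq_tsum]
  refine tsum_congr fun k => ?_
  have : ((k.factorial : ℝ)) ≠ 0 := by positivity
  rw [ascPochhammer_eval_one, pochRatio, smul_eq_mul, inv_mul_cancel₀ this]
  ring

lemma summable_mul_pochRatio {b c : ℝ} (hb : 0 < b) (hc : 0 < c) {x : ℝ} (hx : |x| < 1) :
    Summable fun k : ℕ => (k : ℝ) * pochRatio b c k * x ^ k := by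
  rcases eq_or_ne x 0 with rfl | hx0
  · refine summable_of_ne_finset_zero (s := {0}) fun k hk => ?_
    simp at hk
    simp [hk]
  -- The ratio test needs nonzero terms, and the term k = 0 vanishes.
  rw [← summable_nat_add_iff 1]
  refine summable_of_ratio_test_tendsto_lt_one hx ?_ ?_
  · refine Eventually.of_forall fun k => ?_
    have := pochRatio_pos hb hc (k + 1)
    have h2 : ((k + 1 : ℕ) : ℝ) ≠ 0 := by positivity
    exact mul_ne_zero (mul_ne_zero h2 this.ne') (pow_ne_zero _ hx0)
  · have key : ∀ k : ℕ, ‖((k + 1 + 1 : ℕ) : ℝ) * pochRatio b c (k + 1 + 1) * x ^ (k + 1 + 1)‖ /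
        ‖((k + 1 : ℕ) : ℝ) * pochRatio b c (k + 1) * x ^ (k + 1)‖
        = ((2 + 1 * (k : ℝ)) / (1 + 1 * k)) * ((b + 1 + 1 * k) / (c + 1 + 1 * k)) * |x| := by
      intro k
      have h := pochRatio_succ (b := b) hc (k + 1)
      have h1 := pochRatio_pos hb hc (k + 1)
      have h2 := pochRatio_pos hb hc (k + 1 + 1)
      have h3 : pochRatio b c (k + 1 + 1) = pochRatio b c (k + 1) * (b + (k + 1)) / (c + (k + 1)) := by
        rw [eq_div_iff (by positivity)]
        push_cast at h
        exact h
      rw [norm_mul, norm_mul, norm_mul, norm_mul, norm_pow, norm_pow, Real.norm_of_nonneg h1.le,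
        Real.norm_of_nonneg h2.le, Real.norm_natCast, Real.norm_natCast, h3, Real.norm_eq_abs]
      have : |x| ≠ 0 := abs_ne_zero.2 hx0
      have : (c + 1 + 1 * (k:ℝ)) ≠ 0 := by positivity
      have : (c + (k + 1 : ℝ)) ≠ 0 := by positivity
      push_cast
      field_simp
      ring
    simp_rw [key]
    have h1 := tendsto_add_mul_div_add_mul_atTop_nhds (2 : ℝ) 1 1 (one_ne_zero (α := ℝ))
    have h2 := tendsto_add_mul_div_add_mul_atTop_nhds (b + 1) (c + 1) 1 (one_ne_zero (α := ℝ))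
    simpa using (h1.mul h2).mul_const |x|

lemma summable_pochRatio {b c : ℝ} (hb : 0 < b) (hc : 0 < c) {x : ℝ} (hx : |x| < 1) :
    Summable fun k : ℕ => pochRatio b c k * x ^ k := by
  rw [← summable_nat_add_iff 1]
  refine Summable.of_norm_bounded ((summable_nat_add_iff 1).2
    (summable_mul_pochRatio hb hc hx).norm) fun k => ?_
  rw [norm_mul, norm_mul, norm_mul, mul_assoc, Real.norm_natCast]
  refine le_mul_of_one_le_left (by positivity) ?_
  push_cast
  linarith [(k.cast_nonneg : (0 : ℝ) ≤ k)]

lemma hasDerivAt_hypergeometric_one {b c : ℝ} (hb : 0 < b) (hc : 0 < c) {x : ℝ} (hx : |x| < 1) :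
    HasDerivAt (fun x => ordinaryHypergeometric 1 b c x)
      (∑' k : ℕ, pochRatio b c k * (k * x ^ (k - 1))) x := by
  simp_rw [hypergeometric_one_eq_tsum]
  -- On (-ρ, ρ) the differentiated terms are dominated by their values at ρ, which are summable
  -- because ρ < 1.
  obtain ⟨ρ, h1, h2⟩ := exists_between hx
  have hρ : 0 < ρ := (abs_nonneg x).trans_lt h1
  have hρ' : |ρ| < 1 := by rwa [abs_of_pos hρ]
  have hs : Summable fun k : ℕ => ρ⁻¹ * ((k : ℝ) * pochRatio b c k * ρ ^ k) :=
    (summable_mul_pochRatio hb hc hρ').mul_left _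
  refine hasDerivAt_tsum_of_isPreconnected (t := Set.Ioo (-ρ) ρ) (y₀ := x) hs isOpen_Ioo
    isPreconnected_Ioo (fun k y _ => (hasDerivAt_pow k y).const_mul _) (fun k y hy => ?_)
    (abs_lt.1 h1) (summable_pochRatio hb hc hx) (abs_lt.1 h1)
  have h := pochRatio_pos hb hc k
  rcases k with _ | k
  · simp
  · rw [norm_mul, norm_mul, norm_pow, Real.norm_of_nonneg h.le, Real.norm_natCast,
      Nat.add_sub_cancel, Real.norm_eq_abs]
    have : |y| ^ k ≤ ρ ^ k := pow_le_pow_left₀ (abs_nonneg _) (abs_lt.2 hy).le _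
    calc _ ≤ pochRatio b c (k + 1) * (((k + 1 : ℕ) : ℝ) * ρ ^ k) := by gcongr
      _ = _ := by
        field_simp
        rw [pow_succ]

/-- `₂F₁(1, b; c; x)` solves an inhomogeneous first order equation. -/
lemma hypergeometric_one_ode {b c : ℝ} (hb : 0 < b) (hc : 0 < c) {x : ℝ} (hx : |x| < 1) :
    ∃ F' : ℝ, HasDerivAt (fun x => ordinaryHypergeometric 1 b c x) F' x ∧
      x * (1 - x) * F' + (c - 1 - b * x) * ordinaryHypergeometric 1 b c x = c - 1 := by
  refine ⟨_, hasDerivAt_hypergeometric_one hb hc hx, ?_⟩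
  have s0 := (summable_pochRatio hb hc hx).hasSum
  rw [← hypergeometric_one_eq_tsum] at s0
  have s1 := (summable_mul_pochRatio hb hc hx).hasSum
  have e1 : ∑' k : ℕ, (k : ℝ) * pochRatio b c k * x ^ k =
      x * ∑' k : ℕ, pochRatio b c k * (k * x ^ (k - 1)) := by
    rw [← tsum_mul_left]
    refine tsum_congr fun k => ?_
    rcases k with _ | k
    · simp
    · rw [Nat.add_sub_cancel, pow_succ]
      ring
  rw [e1] at s1
  set F := ordinaryHypergeometric 1 b c x
  set D := ∑' k : ℕ, pochRatio b c k * (k * x ^ (k - 1))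
  -- The recursion (c + k) a_{k+1} = (b + k) a_k is summed: (c - 1) F + x F' without its constant
  -- term c - 1 equals x (b F + x F').
  have t1 := (s0.mul_left (c - 1)).add s1
  have t2 := (hasSum_nat_add_iff' 1).2 t1
  have t3 := ((s0.mul_left b).add s1).mul_left x
  have e : (fun k : ℕ => x * (b * (pochRatio b c k * x ^ k) + k * pochRatio b c k * x ^ k)) =
      fun k : ℕ => (c - 1) * (pochRatio b c (k + 1) * x ^ (k + 1)) +
        ((k + 1 : ℕ) : ℝ) * pochRatio b c (k + 1) * x ^ (k + 1) := by
    funext k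
    have := pochRatio_succ (b := b) hc k
    push_cast
    rw [pow_succ]
    linear_combination (-x ^ k * x) * this
  rw [e] at t3
  have := t2.unique t3
  simp [pochRatio_zero] at this
  linear_combination this

lemma hypergeometric_one_contiguous {b c : ℝ} (hb : 0 < b) (hc : 0 < c) {x : ℝ} (hx : |x| < 1) :
    ordinaryHypergeometric 1 b c x =
      1 + b / c * x * ordinaryHypergeometric 1 (b + 1) (c + 1) x := by
  have s0 := (summable_pochRatio hb hc hx).hasSum
  rw [← hypergeometric_one_eq_tsum] at s0
  have s1 := (summable_pochRatio (b := b + 1) (c := c + 1) (by linarith) (by linarith) hx).hasSum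
  rw [← hypergeometric_one_eq_tsum] at s1
  have t2 := (hasSum_nat_add_iff' 1).2 s0
  have t3 := s1.mul_left (b / c * x)
  have e : (fun k : ℕ => b / c * x * (pochRatio (b + 1) (c + 1) k * x ^ k)) =
      fun k : ℕ => pochRatio b c (k + 1) * x ^ (k + 1) := by
    funext k
    rw [pochRatio_succ_left hc, pow_succ]
    ring
  rw [e] at t3
  have := t2.unique t3
  simp [pochRatio_zero] at this
  linear_combination this

/-! ### The Pfaff continuation -/

/-- Both S⁰ and S¹ have c - a = 1; the Pfaff form then has first parameter 1, so the first order
equation and the contiguous relation for that series apply. -/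
lemma hypNeg_of_sub_eq_one {a b c : ℝ} (h : c - a = 1) (z : ℝ) :
    hypNeg a b c z = (1 + z) ^ (-b) * ordinaryHypergeometric 1 b c (z / (1 + z)) := by
  rw [hypNeg, h]

lemma hypNeg_zero (a b c : ℝ) : hypNeg a b c 0 = 1 := by simp [hypNeg]

lemma abs_div_one_add_lt_one {z : ℝ} (hz : 0 ≤ z) : |z / (1 + z)| < 1 := by
  rw [abs_of_nonneg (by positivity), div_lt_one (by positivity)]
  linarith

/-- `z S' + (c - 1) S = (c - 1) (1 + z)^(-b)` for `S(z) = ₂F₁(c - 1, b; c; -z)`. -/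
lemma hypNeg_ode {a b c : ℝ} (h : c - a = 1) (hb : 0 < b) (hc : 0 < c) {z : ℝ} (hz : 0 ≤ z) :
    ∃ D : ℝ, HasDerivAt (hypNeg a b c) D z ∧
      z * D + (c - 1) * hypNeg a b c z = (c - 1) * (1 + z) ^ (-b) := by
  obtain ⟨F', hF, hode⟩ := hypergeometric_one_ode hb hc (abs_div_one_add_lt_one hz)
  have h1 : (1 + z) ≠ 0 := by positivity
  have hd : HasDerivAt (fun z : ℝ => z / (1 + z)) (1 / (1 + z) ^ 2) z := by
    have := (hasDerivAt_id z).div ((hasDerivAt_id z).const_add 1) h1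
    convert! this using 1
    simp
  have hp : HasDerivAt (fun z : ℝ => (1 + z) ^ (-b)) (-b * (1 + z) ^ (-b - 1)) z := by
    have := ((hasDerivAt_id z).const_add 1).rpow_const (p := -b) (Or.inl h1)
    convert! this using 1
    simp
  have hcomp := HasDerivAt.comp z hF hd
  have hmul := hp.mul hcomp
  have hfun : hypNeg a b c = (fun z : ℝ => (1 + z) ^ (-b)) *
      ((fun x => ordinaryHypergeometric 1 b c x) ∘ fun z : ℝ => z / (1 + z)) := by
    funext z
    exact hypNeg_of_sub_eq_one h z
  refine ⟨_, hfun ▸ hmul, ?_⟩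
  rw [hypNeg_of_sub_eq_one h]
  simp only [Function.comp]
  rw [Real.rpow_sub_one h1]
  set F := ordinaryHypergeometric 1 b c (z / (1 + z))
  field_simp at hode ⊢
  linear_combination hode

/-- Used to pass from S⁰, whose first parameter -2/α is negative, to S¹, whose parameter 1 - 2/α is
positive when α > 2, as the integral representation behind `tendsto_rpow_mul_hypNeg` requires. -/
lemma hypNeg_contiguous {a b c : ℝ} (h : c - a = 1) (hb : 0 < b) (hc : 0 < c) {z : ℝ}
    (hz : 0 ≤ z) :
    hypNeg a b c z = (1 + z) ^ (-b) + b / c * z * hypNeg (a + 1) (b + 1) (c + 1) z := by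
  have h1 : (1 + z) ≠ 0 := by positivity
  rw [hypNeg_of_sub_eq_one h, hypNeg_of_sub_eq_one (by linarith),
    hypergeometric_one_contiguous hb hc (abs_div_one_add_lt_one hz), neg_add',
    Real.rpow_sub_one h1]
  field_simp

/-! ### The beta integral on the half-line and the growth of `₂F₁` at infinity -/

lemma lintegral_rpow_mul_exp_neg_mul {a r : ℝ} (ha : 0 < a) (hr : 0 < r) :
    ∫⁻ t in Set.Ioi (0 : ℝ), ENNReal.ofReal (t ^ (a - 1) * Real.exp (-(r * t))) =
      ENNReal.ofReal ((1 / r) ^ a * Real.Gamma a) := by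
  have h := Real.integral_rpow_mul_exp_neg_mul_Ioi ha hr
  have hpos : 0 < (1 / r) ^ a * Real.Gamma a :=
    mul_pos (Real.rpow_pos_of_pos (by positivity) _) (Real.Gamma_pos_of_pos ha)
  have hi : IntegrableOn (fun t : ℝ => t ^ (a - 1) * Real.exp (-(r * t))) (Set.Ioi 0) := by
    -- A non-integrable function would have integral 0, contradicting the positive value of the
    -- integral.
    by_contra hcon
    rw [integral_undef hcon] at h
    exact hpos.ne h
  rw [← h, ofReal_integral_eq_lintegral_ofReal hi]
  filter_upwards [ae_restrict_mem measurableSet_Ioi] with t ht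
  exact mul_nonneg (Real.rpow_nonneg (le_of_lt ht) _) (Real.exp_pos _).le

/-- Write Γ(b) (1 + u)^(-b) as the Gamma integral of x^(b-1) e^(-(1+u)x) and exchange the integrals.
With nonnegative integrals Tonelli needs no prior integrability, which is instead a consequence. -/
lemma lintegral_rpow_mul_one_add_rpow {e b : ℝ} (he : 0 < e) (hb : e < b) :
    ∫⁻ u in Set.Ioi (0 : ℝ), ENNReal.ofReal (u ^ (e - 1) * (1 + u) ^ (-b)) =
      ENNReal.ofReal (Real.Gamma e * Real.Gamma (b - e) / Real.Gamma b) := by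
  have hb0 : 0 < b := he.trans hb
  have hG := Real.Gamma_pos_of_pos hb0
  have h1 : ∀ u ∈ Set.Ioi (0 : ℝ), ENNReal.ofReal (Real.Gamma b) *
      ENNReal.ofReal (u ^ (e - 1) * (1 + u) ^ (-b)) = ∫⁻ x in Set.Ioi (0 : ℝ),
        ENNReal.ofReal (u ^ (e - 1) * (x ^ (b - 1) * Real.exp (-((1 + u) * x)))) := by
    intro u hu
    have hu0 : (0 : ℝ) < u := hu
    have hu1 : 0 ≤ u ^ (e - 1) := Real.rpow_nonneg hu0.le _
    simp_rw [ENNReal.ofReal_mul hu1]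
    rw [lintegral_const_mul' _ _ ENNReal.ofReal_ne_top,
      lintegral_rpow_mul_exp_neg_mul hb0 (by positivity), mul_left_comm,
      ← ENNReal.ofReal_mul hG.le]
    congr 2
    rw [one_div, Real.inv_rpow (by positivity), Real.rpow_neg (by positivity), mul_comm]
  have h2 : ∀ x ∈ Set.Ioi (0 : ℝ), (∫⁻ u in Set.Ioi (0 : ℝ),
        ENNReal.ofReal (u ^ (e - 1) * (x ^ (b - 1) * Real.exp (-((1 + u) * x))))) =
      ENNReal.ofReal (Real.Gamma e) * ENNReal.ofReal (x ^ (b - e - 1) * Real.exp (-(1 * x))) := by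
    intro x hx
    have hx0 : (0 : ℝ) < x := hx
    have hc : 0 ≤ x ^ (b - 1) * Real.exp (-x) :=
      mul_nonneg (Real.rpow_nonneg hx0.le _) (Real.exp_pos _).le
    have : ∀ u : ℝ, u ^ (e - 1) * (x ^ (b - 1) * Real.exp (-((1 + u) * x))) =
        (x ^ (b - 1) * Real.exp (-x)) * (u ^ (e - 1) * Real.exp (-(x * u))) := by
      intro u
      rw [show -((1 + u) * x) = -x + -(x * u) by ring, Real.exp_add]
      ring
    simp_rw [this, ENNReal.ofReal_mul hc]
    rw [lintegral_const_mul' _ _ ENNReal.ofReal_ne_top, lintegral_rpow_mul_exp_neg_mul he hx0,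
      ← ENNReal.ofReal_mul hc, ← ENNReal.ofReal_mul (Real.Gamma_pos_of_pos he).le]
    congr 1
    rw [one_div, Real.inv_rpow hx0.le, show b - e - 1 = (b - 1) - e by ring,
      Real.rpow_sub hx0 (b - 1) e, one_mul]
    field_simp
  have h3 : ENNReal.ofReal (Real.Gamma b) *
      ∫⁻ u in Set.Ioi (0 : ℝ), ENNReal.ofReal (u ^ (e - 1) * (1 + u) ^ (-b)) =
      ENNReal.ofReal (Real.Gamma e * Real.Gamma (b - e)) := by
    rw [← lintegral_const_mul' _ _ ENNReal.ofReal_ne_top,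
      setLIntegral_congr_fun measurableSet_Ioi h1,
      lintegral_lintegral_swap (by
        apply Measurable.aemeasurable
        unfold Function.uncurry
        fun_prop),
      setLIntegral_congr_fun measurableSet_Ioi h2,
      lintegral_const_mul' _ _ ENNReal.ofReal_ne_top,
      lintegral_rpow_mul_exp_neg_mul (by linarith) one_pos,
      ← ENNReal.ofReal_mul (Real.Gamma_pos_of_pos he).le]
    simp
  rw [ENNReal.ofReal_div_of_pos hG, ENNReal.eq_div_iff (by simpa using hG) ENNReal.ofReal_ne_top,
    h3]

lemma integral_rpow_mul_one_add_rpow {e b : ℝ} (he : 0 < e) (hb : e < b) :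
    IntegrableOn (fun u : ℝ => u ^ (e - 1) * (1 + u) ^ (-b)) (Set.Ioi 0) ∧
    ∫ u in Set.Ioi (0 : ℝ), u ^ (e - 1) * (1 + u) ^ (-b) =
      Real.Gamma e * Real.Gamma (b - e) / Real.Gamma b := by
  have h := lintegral_rpow_mul_one_add_rpow he hb
  have hnn : 0 ≤ᵐ[volume.restrict (Set.Ioi (0 : ℝ))]
      fun u : ℝ => u ^ (e - 1) * (1 + u) ^ (-b) := by
    filter_upwards [ae_restrict_mem measurableSet_Ioi] with u hu
    have : (0 : ℝ) < u := hu
    exact mul_nonneg (Real.rpow_nonneg this.le _) (Real.rpow_nonneg (by positivity) _)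
  have hm : AEStronglyMeasurable (fun u : ℝ => u ^ (e - 1) * (1 + u) ^ (-b))
      (volume.restrict (Set.Ioi (0 : ℝ))) := by
    apply Measurable.aestronglyMeasurable
    fun_prop
  refine ⟨⟨hm, ?_⟩, ?_⟩
  · rw [hasFiniteIntegral_iff_ofReal hnn, h]
    exact ENNReal.ofReal_lt_top
  · rw [integral_eq_lintegral_of_nonneg_ae hnn hm, h, ENNReal.toReal_ofReal]
    exact (div_pos (mul_pos (Real.Gamma_pos_of_pos he) (Real.Gamma_pos_of_pos (by linarith)))
      (Real.Gamma_pos_of_pos (he.trans hb))).le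

/-- With c - 1 = a, the equation of `hypNeg_ode` says that z^a S(z) has derivative a z^(a-1) (1 +
z)^(-b). As a > 0 it vanishes at 0, so it is a times a truncated beta integral. -/
lemma tendsto_rpow_mul_hypNeg {a b c : ℝ} (h : c - a = 1) (ha : 0 < a) (hab : a < b) :
    Tendsto (fun z => z ^ a * hypNeg a b c z) atTop
      (𝓝 (a * (Real.Gamma a * Real.Gamma (b - a) / Real.Gamma b))) := by
  obtain ⟨hi, hv⟩ := integral_rpow_mul_one_add_rpow ha hab
  have hb : 0 < b := ha.trans hab
  have hc : 0 < c := by linarith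
  have ht := (intervalIntegral_tendsto_integral_Ioi 0 hi tendsto_id).const_mul a
  rw [hv] at ht
  refine ht.congr' ?_
  filter_upwards [eventually_ge_atTop 0] with z hz
  have hcont : ContinuousOn (fun z => z ^ a * hypNeg a b c z) (Set.Icc 0 z) := by
    intro x hx
    obtain ⟨D, hD, -⟩ := hypNeg_ode h hb hc hx.1
    exact ((Real.continuous_rpow_const ha.le).continuousAt.mul
      hD.continuousAt).continuousWithinAt
  have hder : ∀ x ∈ Set.Ioo 0 z, HasDerivAt (fun z => z ^ a * hypNeg a b c z)
      (a * (x ^ (a - 1) * (1 + x) ^ (-b))) x := by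
    intro x hx
    obtain ⟨D, hD, hode⟩ := hypNeg_ode h hb hc hx.1.le
    have hx0 := hx.1
    have := (Real.hasDerivAt_rpow_const (p := a) (Or.inl hx0.ne')).mul hD
    convert! this using 1
    have e : x ^ a = x ^ (a - 1) * x := by
      rw [Real.rpow_sub_one hx0.ne']
      field_simp
    rw [show c - 1 = a by linarith] at hode
    rw [e]
    linear_combination (-x ^ (a - 1)) * hode
  have hint : IntervalIntegrable (fun x : ℝ => a * (x ^ (a - 1) * (1 + x) ^ (-b)))
      volume 0 z := by
    rw [intervalIntegrable_iff_integrableOn_Ioc_of_le hz]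
    exact (hi.mono_set Set.Ioc_subset_Ioi_self).const_mul a
  rw [id, ← intervalIntegral.integral_const_mul,
    intervalIntegral.integral_eq_sub_of_hasDerivAt_of_le hz hcont hder hint]
  simp [Real.zero_rpow ha.ne']

namespace PicoTier

variable (T : PicoTier)

/-! ### The functions `S⁰`, `S¹` and `Δ` -/

lemma α_pos : 0 < T.α := two_pos.trans_le T.two_le_α

lemma N_cast_pos : (0 : ℝ) < T.N := Nat.cast_pos.2 T.N_pos

lemma two_div_α_pos : 0 < 2 / T.α := div_pos two_pos T.α_pos

lemma two_div_α_lt_one (h : T.α ≠ 2) : 2 / T.α < 1 := by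
  rw [div_lt_one T.α_pos]
  exact lt_of_le_of_ne T.two_le_α h.symm

lemma S_zero_eq : T.S 0 = hypNeg (-(2 / T.α)) T.N (1 - 2 / T.α) := by
  funext z
  simp [S]

lemma S_one_eq : T.S 1 = hypNeg (-(2 / T.α) + 1) (T.N + 1) (1 - 2 / T.α + 1) := by
  funext z
  simp only [S, Nat.cast_one]
  congr 1 <;> ring

lemma one_add_rpow_neg {z : ℝ} (hz : 0 ≤ z) : (1 + z) ^ (-(T.N : ℝ)) = ((1 + z) ^ T.N)⁻¹ := by
  rw [Real.rpow_neg (by positivity), Real.rpow_natCast]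

lemma S_zero_ode (h : T.α ≠ 2) {z : ℝ} (hz : 0 ≤ z) :
    ∃ D : ℝ, HasDerivAt (T.S 0) D z ∧
      z * D = 2 / T.α * (T.S 0 z - ((1 + z) ^ T.N)⁻¹) := by
  have h1 := T.two_div_α_lt_one h
  obtain ⟨D, hD, hode⟩ := hypNeg_ode (a := -(2 / T.α)) (c := 1 - 2 / T.α) (by ring)
    T.N_cast_pos (by linarith) hz
  rw [S_zero_eq, ← T.one_add_rpow_neg hz]
  exact ⟨D, hD, by linear_combination hode⟩

lemma S_zero_sub (h : T.α ≠ 2) {z : ℝ} (hz : 0 ≤ z) :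
    T.S 0 z - ((1 + z) ^ T.N)⁻¹ = T.N / (1 - 2 / T.α) * z * T.S 1 z := by
  have h1 := T.two_div_α_lt_one h
  rw [S_zero_eq, ← T.one_add_rpow_neg hz, S_one_eq, hypNeg_contiguous (by ring)
    T.N_cast_pos (by linarith) hz]
  ring

lemma tendsto_one_add_pow_inv {k : ℕ} (hk : k ≠ 0) :
    Tendsto (fun z : ℝ => ((1 + z) ^ k)⁻¹) atTop (𝓝 0) :=
  ((tendsto_pow_atTop hk).comp (tendsto_atTop_add_const_left _ 1 tendsto_id)).inv_tendsto_atTop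

/-- By `S_zero_sub` the growth of S⁰ is that of z S¹(z), whose constant is a beta integral. The
limit is exactly the coefficient of z^(2/α) in Δ, so Δ cancels the leading growth of S⁰. -/
lemma tendsto_rpow_mul_S_zero (h : T.α ≠ 2) :
    Tendsto (fun z => z ^ (-(2 / T.α)) * T.S 0 z) atTop
      (𝓝 (Real.Gamma (1 - 2 / T.α) * Real.Gamma (T.N + 2 / T.α) * (Real.Gamma T.N)⁻¹)) := by
  have h1 := T.two_div_α_lt_one h
  have h0 := T.two_div_α_pos
  have hN := T.N_cast_pos
  have t1 := (tendsto_rpow_mul_hypNeg (a := -(2 / T.α) + 1) (b := T.N + 1)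
    (c := 1 - 2 / T.α + 1) (by ring) (by linarith) (by linarith)).const_mul
    (T.N / (1 - 2 / T.α))
  have t2 := (tendsto_rpow_neg_atTop h0).mul (tendsto_one_add_pow_inv T.N_pos.ne')
  have t3 := t2.add t1
  rw [← S_one_eq] at t3
  have hG : Real.Gamma T.N ≠ 0 := (Real.Gamma_pos_of_pos hN).ne'
  have e : 0 * 0 + T.N / (1 - 2 / T.α) * ((-(2 / T.α) + 1) * (Real.Gamma (-(2 / T.α) + 1) *
      Real.Gamma (T.N + 1 - (-(2 / T.α) + 1)) / Real.Gamma (T.N + 1))) =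
      Real.Gamma (1 - 2 / T.α) * Real.Gamma (T.N + 2 / T.α) * (Real.Gamma T.N)⁻¹ := by
    have h2 : 1 - 2 / T.α ≠ 0 := by linarith
    rw [Real.Gamma_add_one hN.ne', show -(2 / T.α) + 1 = 1 - 2 / T.α by ring,
      show (T.N : ℝ) + 1 - (1 - 2 / T.α) = T.N + 2 / T.α by ring]
    generalize 1 - 2 / T.α = q at *
    field_simp
    ring
  rw [e] at t3
  refine t3.congr' ?_
  filter_upwards [eventually_gt_atTop 0] with z hz
  have := T.S_zero_sub h hz.le
  have e2 : z ^ (-(2 / T.α) + 1) = z ^ (-(2 / T.α)) * z := Real.rpow_add_one hz.ne' _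
  rw [e2]
  linear_combination (-z ^ (-(2 / T.α))) * this

lemma hasDerivAt_Delta {z : ℝ} (hz : 0 < z) : HasDerivAt T.Delta (2 / T.α * T.Delta z / z) z := by
  have := (Real.hasDerivAt_rpow_const (x := z) (p := 2 / T.α) (Or.inl hz.ne')).const_mul
    (Real.Gamma (1 - 2 / T.α) * Real.Gamma (T.N + 2 / T.α) * (Real.Gamma T.N)⁻¹)
  convert! this using 1
  rw [Delta, Real.rpow_sub_one hz.ne']
  ring

/-- This homogeneity makes the Δ parts of the kernel at radii r and R proportional, so that they
combine into the single term with factor 1 - p. -/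
lemma Delta_mul {x y : ℝ} (hx : 0 ≤ x) (hy : 0 ≤ y) :
    T.Delta (x * y ^ T.α) = T.Delta x * y ^ 2 := by
  have : (y ^ T.α) ^ (2 / T.α) = y ^ 2 := by
    rw [← Real.rpow_mul hy, mul_div_cancel₀ _ T.α_pos.ne', Real.rpow_two]
  rw [Delta, Delta, Real.mul_rpow hx (Real.rpow_nonneg hy _), this]
  ring

lemma mul_Lam {z : ℝ} (hz : 0 ≤ z) : z * T.Lam z = 2 / T.α * T.Delta z := by
  rcases hz.eq_or_lt with rfl | hz
  · simp [Delta, Real.zero_rpow T.two_div_α_pos.ne']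
  · rw [Lam, Delta, Real.rpow_sub_one hz.ne']
    field_simp

/-! ### The function `F_y` -/

/-- The summand of `f_y` besides `F_y`. -/
lemma fy_bracket {y : ℝ} (hy : 0 < y) :
    (T.N * y + 1) / (y ^ 2 * (1 + y) ^ T.N) - T.N / (y * (1 + y))
      + ∑ m ∈ Finset.Icc 1 (T.N - 1), (T.N : ℝ) / (1 + y) ^ (T.N - m + 1) =
    ((1 + y) ^ T.N)⁻¹ / y ^ 2 := by
  -- A finite geometric sum; with n = N - 1 it cancels the term N / (y (1 + y)) of the bracket.
  have hs : ∀ n : ℕ, ∑ j ∈ Finset.Icc 1 n, (T.N : ℝ) / (1 + y) ^ (j + 1) =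
      T.N / (y * (1 + y)) - T.N / (y * (1 + y) ^ (n + 1)) := by
    intro n
    induction n with
    | zero => simp
    | succ n ih =>
      rw [Finset.sum_Icc_succ_top (by omega), ih]
      field_simp
      ring
  have hr : ∑ m ∈ Finset.Icc 1 (T.N - 1), (T.N : ℝ) / (1 + y) ^ (T.N - m + 1) =
      ∑ j ∈ Finset.Icc 1 (T.N - 1), (T.N : ℝ) / (1 + y) ^ (j + 1) := by
    refine Finset.sum_nbij' (fun m => T.N - m) (fun m => T.N - m) ?_ ?_ ?_ ?_ ?_ <;>
      intro m hm <;> simp only [Finset.mem_Icc] at hm ⊢ <;> omega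
  rw [hr, hs, Nat.sub_add_cancel T.N_pos]
  field_simp
  ring

/-- The derivatives of the three parts of F_y assemble into the bracket of f_y, which collapses by
`fy_bracket`. Together with the limit 0 at infinity this characterises F_y(y) as -∫_y^∞ (1 + u)^(-N)
u^(-2) du. -/
lemma hasDerivAt_Fy {y : ℝ} (hy : 0 < y) : HasDerivAt T.Fy (((1 + y) ^ T.N)⁻¹ / y ^ 2) y := by
  have h1 : 1 + y ≠ 0 := by positivity
  have h2 : 1 + 1 / y ≠ 0 := by positivity
  have d1 : HasDerivAt (fun y : ℝ => 1 + y) 1 y := (hasDerivAt_id y).const_add 1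
  have dl : HasDerivAt (fun y : ℝ => T.N * Real.log (1 + 1 / y)) (-(T.N / (y * (1 + y)))) y := by
    have d0 : HasDerivAt (fun y : ℝ => 1 + 1 / y) (-(y ^ 2)⁻¹) y := by
      simpa using (hasDerivAt_inv hy.ne').const_add 1
    convert! (d0.log h2).const_mul (T.N : ℝ) using 1
    field_simp
    ring
  have dq : HasDerivAt (fun y : ℝ => 1 / (y * (1 + y) ^ (T.N - 1)))
      (-((T.N * y + 1) / (y ^ 2 * (1 + y) ^ T.N))) y := by
    have := ((hasDerivAt_id y).mul (d1.pow (T.N - 1))).inv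
      (mul_ne_zero hy.ne' (pow_ne_zero _ h1))
    obtain ⟨n, hn⟩ : ∃ n, T.N = n + 1 := ⟨T.N - 1, (Nat.sub_add_cancel T.N_pos).symm⟩
    simp only [one_div]
    convert! this using 1
    rcases n with _ | n
    · simp [hn]
      field_simp
      ring
    · simp [hn]
      field_simp
      ring
  have ds : HasDerivAt
      (fun y : ℝ => ∑ m ∈ Finset.Icc 1 (T.N - 1), (T.N : ℝ) / ((1 + y) ^ (T.N - m) * ((T.N : ℝ) - m)))
      (∑ m ∈ Finset.Icc 1 (T.N - 1), -((T.N : ℝ) / (1 + y) ^ (T.N - m + 1))) y := by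
    refine HasDerivAt.fun_sum fun m hm => ?_
    rw [Finset.mem_Icc] at hm
    obtain ⟨k, hk⟩ : ∃ k, T.N = k + 1 + m := ⟨T.N - m - 1, by omega⟩
    have e : (T.N : ℝ) - m = k + 1 := by
      rw [hk]
      push_cast
      ring
    rw [e, show T.N - m = k + 1 by omega]
    have hk1 : (k : ℝ) + 1 ≠ 0 := by positivity
    have := ((d1.pow (k + 1)).mul_const ((k : ℝ) + 1)).inv (mul_ne_zero (pow_ne_zero _ h1) hk1)
    have := this.const_mul (T.N : ℝ)
    simp only [div_eq_mul_inv]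
    convert! this using 1
    simp
    field_simp
    ring
  have := (dl.sub dq).sub ds
  rw [← T.fy_bracket hy]
  convert! this using 1
  rw [Finset.sum_neg_distrib]
  ring

lemma tendsto_Fy_atTop : Tendsto T.Fy atTop (𝓝 0) := by
  have hl : Tendsto (fun y : ℝ => T.N * Real.log (1 + 1 / y)) atTop (𝓝 0) := by
    have h1 : Tendsto (fun y : ℝ => 1 + 1 / y) atTop (𝓝 1) := by
      simpa using tendsto_inv_atTop_zero.const_add (1 : ℝ)
    have := ((Real.continuousAt_log one_ne_zero).tendsto.comp h1).const_mul (T.N : ℝ)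
    simpa using this
  have hq : Tendsto (fun y : ℝ => 1 / (y * (1 + y) ^ (T.N - 1))) atTop (𝓝 0) := by
    refine squeeze_zero' ?_ ?_ tendsto_inv_atTop_zero
    · filter_upwards [eventually_gt_atTop 0] with y hy
      positivity
    · filter_upwards [eventually_gt_atTop 0] with y hy
      rw [one_div]
      refine inv_anti₀ hy (le_mul_of_one_le_right hy.le (one_le_pow₀ (by linarith)))
  have hs : Tendsto (fun y : ℝ => ∑ m ∈ Finset.Icc 1 (T.N - 1),
      (T.N : ℝ) / ((1 + y) ^ (T.N - m) * ((T.N : ℝ) - m))) atTop (𝓝 0) := by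
    rw [← Finset.sum_const_zero (s := Finset.Icc 1 (T.N - 1))]
    refine tendsto_finsetSum _ fun m hm => ?_
    rw [Finset.mem_Icc] at hm
    have := (tendsto_one_add_pow_inv (k := T.N - m) (by omega)).const_mul
      (T.N / ((T.N : ℝ) - m))
    rw [mul_zero] at this
    refine this.congr fun y => ?_
    rw [div_mul_eq_div_div_swap, ← div_eq_mul_inv]
  have := (hl.sub hq).sub hs
  rw [sub_zero, sub_zero] at this
  exact this

/-- The logarithm is split so that the only singular expression is y log y, which extends
continuously to y = 0; the right-hand side then tends to -1. -/
lemma mul_Fy {y : ℝ} (hy : 0 < y) : y * T.Fy y =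
    T.N * (y * Real.log (1 + y) - y * Real.log y) - ((1 + y) ^ (T.N - 1))⁻¹
      - y * ∑ m ∈ Finset.Icc 1 (T.N - 1), (T.N : ℝ) / ((1 + y) ^ (T.N - m) * ((T.N : ℝ) - m)) := by
  have : 1 + 1 / y = (1 + y) / y := by field_simp; ring
  rw [Fy, this, Real.log_div (by positivity) hy.ne']
  field_simp

/-! ### The kernel `-2 ∫₀¹ (1 + y v^(-α))^(-N) v dv` -/

/-- The closed form of `-2 ∫₀¹ (1 + y v^(-α))^(-N) v dv` for `y ≥ 0`, continued as a constant. -/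
def discKernel (y : ℝ) : ℝ :=
  if T.α = 2 then if y ≤ 0 then -1 else y * T.Fy y
  else T.Delta (max y 0) - T.S 0 (max y 0)

/-- `y K'(y)` for the kernel `K = discKernel`. -/
def discKernelDeriv (y : ℝ) : ℝ := 2 / T.α * (T.discKernel y + ((1 + max y 0) ^ T.N)⁻¹)

lemma discKernel_zero : T.discKernel 0 = -1 := by
  rw [discKernel]
  split_ifs with h h'
  · rfl
  · exact absurd le_rfl h'
  · simp [Delta, S, hypNeg_zero, Real.zero_rpow T.two_div_α_pos.ne']

lemma discKernelDeriv_zero : T.discKernelDeriv 0 = 0 := by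
  simp [discKernelDeriv, discKernel_zero]

lemma continuous_discKernel : Continuous T.discKernel := by
  by_cases h : T.α = 2
  · have e : T.discKernel = fun y =>
        T.N * (max y 0 * Real.log (1 + max y 0) - max y 0 * Real.log (max y 0)) -
          ((1 + max y 0) ^ (T.N - 1))⁻¹ - max y 0 * ∑ m ∈ Finset.Icc 1 (T.N - 1),
            (T.N : ℝ) / ((1 + max y 0) ^ (T.N - m) * ((T.N : ℝ) - m)) := by
      funext y
      rw [discKernel, if_pos h]
      split_ifs with hy
      · simp [max_eq_right hy]
      · rw [max_eq_left (not_le.1 hy).le, T.mul_Fy (not_le.1 hy)]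
    have hpos : ∀ y : ℝ, 1 + max y 0 ≠ 0 := fun y => by positivity
    rw [e]
    refine ((continuous_const.mul (Continuous.sub ?_ ?_)).sub ?_).sub ?_
    · refine Continuous.mul (by fun_prop) (Continuous.log (by fun_prop) hpos)
    -- Here the default `Real.log 0 = 0` gives y log y its limit value 0 at y = 0.
    · exact Real.continuous_mul_log.comp (by fun_prop)
    · exact Continuous.inv₀ (by fun_prop) fun y => pow_ne_zero _ (hpos y)
    · refine Continuous.mul (by fun_prop) (continuous_finsetSum _ fun m hm => ?_)
      rw [Finset.mem_Icc] at hm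
      refine continuous_const.div (by fun_prop) fun y => mul_ne_zero (pow_ne_zero _ (hpos y)) ?_
      have : (m : ℝ) < T.N := Nat.cast_lt.2 (by omega)
      linarith
  · have e : T.discKernel = fun y => T.Delta (max y 0) - T.S 0 (max y 0) := by
      funext y
      rw [discKernel, if_neg h]
    rw [e]
    refine Continuous.sub ?_ ?_
    · exact continuous_const.mul ((Real.continuous_rpow_const T.two_div_α_pos.le).comp
        (by fun_prop))
    · refine continuous_iff_continuousAt.2 fun y => ?_
      obtain ⟨D, hD, -⟩ := T.S_zero_ode h (le_max_right y 0)
      exact ContinuousAt.comp (f := fun y : ℝ => max y 0) hD.continuousAt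
        (by fun_prop)

lemma continuous_discKernelDeriv : Continuous T.discKernelDeriv := by
  unfold discKernelDeriv
  refine continuous_const.mul (T.continuous_discKernel.add (Continuous.inv₀ (by fun_prop) ?_))
  intro y
  positivity

/-- Both closed forms solve y K' = (2/α)(K + (1 + y)^(-N)). For α ≠ 2, Δ solves the homogeneous
equation and -S⁰ the inhomogeneous one; for α = 2 it is the product rule with the derivative of F_y.
-/
lemma hasDerivAt_discKernel {y : ℝ} (hy : 0 < y) :
    HasDerivAt T.discKernel (T.discKernelDeriv y / y) y := by
  by_cases h : T.α = 2
  · have e : T.discKernel =ᶠ[𝓝 y] fun y => y * T.Fy y := by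
      filter_upwards [eventually_gt_nhds hy] with z hz
      rw [discKernel, if_pos h, if_neg (not_le.2 hz)]
    refine HasDerivAt.congr_of_eventuallyEq ?_ e
    convert! (hasDerivAt_id y).mul (T.hasDerivAt_Fy hy) using 1
    rw [discKernelDeriv, e.eq_of_nhds, h, max_eq_left hy.le]
    simp
    field_simp
  · have e : T.discKernel =ᶠ[𝓝 y] fun y => T.Delta y - T.S 0 y := by
      filter_upwards [eventually_gt_nhds hy] with z hz
      rw [discKernel, if_neg h, max_eq_left hz.le]
    refine HasDerivAt.congr_of_eventuallyEq ?_ e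
    obtain ⟨D, hD, hode⟩ := T.S_zero_ode h hy.le
    convert! (T.hasDerivAt_Delta hy).sub hD using 1
    rw [discKernelDeriv, e.eq_of_nhds, max_eq_left hy.le]
    have hD' : D = 2 / T.α * (T.S 0 y - ((1 + y) ^ T.N)⁻¹) / y := by
      rw [eq_div_iff hy.ne']
      linarith
    rw [hD']
    ring

/-- Solutions of the equation for K differ by multiples of y^(2/α) on y > 0; this decay singles out
the one that gives the disc integral. -/
lemma tendsto_rpow_mul_discKernel :
    Tendsto (fun y => y ^ (-(2 / T.α)) * T.discKernel y) atTop (𝓝 0) := by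
  by_cases h : T.α = 2
  · refine T.tendsto_Fy_atTop.congr' ?_
    filter_upwards [eventually_gt_atTop 0] with y hy
    rw [discKernel, if_pos h, if_neg (not_le.2 hy), h, div_self two_ne_zero, Real.rpow_neg_one]
    field_simp
  · have := (T.tendsto_rpow_mul_S_zero h).const_sub
      (Real.Gamma (1 - 2 / T.α) * Real.Gamma (T.N + 2 / T.α) * (Real.Gamma T.N)⁻¹)
    rw [sub_self] at this
    refine this.congr' ?_
    filter_upwards [eventually_gt_atTop 0] with y hy
    rw [discKernel, if_neg h, max_eq_left hy.le, Delta, Real.rpow_neg hy.le]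
    have := (Real.rpow_pos_of_pos hy (2 / T.α)).ne'
    field_simp

/-- Radial form of the kernel: the fading-averaged interference exponent of a disc. -/
lemma integral_disc {X : ℝ} (hX : 0 ≤ X) {ρ : ℝ} (hρ : 0 ≤ ρ) :
    IntegrableOn (fun v : ℝ => v * (1 - ((1 + X * v ^ (-T.α)) ^ T.N)⁻¹)) (Set.Ioc 0 ρ) ∧
    ∫ v in Set.Ioc 0 ρ, v * (1 - ((1 + X * v ^ (-T.α)) ^ T.N)⁻¹) =
      ρ ^ 2 / 2 * (1 + T.discKernel (X / ρ ^ T.α)) := by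
  rcases hX.eq_or_lt with rfl | hX
  · simp [discKernel_zero]
  have hα := T.α_pos
  set H : ℝ → ℝ := fun v => v ^ 2 / 2 * (1 + T.discKernel (X * v ^ (-T.α))) with hH
  -- With y = X v^(-α) the chain rule contributes -(α/2) v · y K'(y) = -v (K(y) + (1 + y)^(-N)),
  -- which cancels v K(y).
  have hder : ∀ v : ℝ, 0 < v →
      HasDerivAt H (v * (1 - ((1 + X * v ^ (-T.α)) ^ T.N)⁻¹)) v := by
    intro v hv
    have hy : 0 < X * v ^ (-T.α) := mul_pos hX (Real.rpow_pos_of_pos hv _)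
    have d1 : HasDerivAt (fun v : ℝ => X * v ^ (-T.α)) (X * (-T.α * v ^ (-T.α - 1))) v :=
      (Real.hasDerivAt_rpow_const (Or.inl hv.ne')).const_mul X
    have d2 := (HasDerivAt.comp v (T.hasDerivAt_discKernel hy) d1).const_add 1
    have d3 := ((hasDerivAt_pow 2 v).div_const 2).mul d2
    convert! d3 using 1
    rw [discKernelDeriv, max_eq_left hy.le, Real.rpow_sub_one hv.ne']
    have := (Real.rpow_pos_of_pos hv (-T.α)).ne'
    simp only [Function.comp]
    field_simp
    push_cast
    ring
  have hcont : ContinuousOn H (Set.Icc 0 ρ) := by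
    intro v hv
    rcases hv.1.eq_or_lt with rfl | hv0
    · have h0 : H 0 = 0 := by simp [hH]
      suffices Tendsto H (𝓝[>] 0) (𝓝 0) by
        have h' : ContinuousWithinAt H (Set.Ici 0) 0 := by
          rw [← Set.Ioi_insert, continuousWithinAt_insert_self]
          change Tendsto H (𝓝[>] 0) (𝓝 (H 0))
          rwa [h0]
        exact h'.mono Set.Icc_subset_Ici_self
      -- As v → 0 the argument y = X v^(-α) tends to infinity, and v² K(y) = X^(2/α) y^(-2/α) K(y)
      -- tends to 0.
      have ht : Tendsto (fun v : ℝ => X * v ^ (-T.α)) (𝓝[>] 0) atTop :=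
        (tendsto_rpow_neg_nhdsGT_zero (by linarith)).const_mul_atTop hX
      have h1 := (T.tendsto_rpow_mul_discKernel.comp ht).const_mul (X ^ (2 / T.α) / 2)
      have h2 : Tendsto (fun v : ℝ => v ^ 2 / 2) (𝓝[>] 0) (𝓝 0) := by
        have : Continuous fun v : ℝ => v ^ 2 / 2 := by fun_prop
        simpa using (this.tendsto 0).mono_left nhdsWithin_le_nhds
      have h3 := h2.add h1
      rw [mul_zero, add_zero] at h3
      refine h3.congr' ?_
      filter_upwards [self_mem_nhdsWithin] with v hv
      have hv : (0 : ℝ) < v := hv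
      have e : (X * v ^ (-T.α)) ^ (-(2 / T.α)) = X ^ (-(2 / T.α)) * v ^ 2 := by
        rw [Real.mul_rpow hX.le (Real.rpow_nonneg hv.le _), ← Real.rpow_mul hv.le,
          show -T.α * -(2 / T.α) = 2 by field_simp, Real.rpow_two]
      have := (Real.rpow_pos_of_pos hX (2 / T.α)).ne'
      simp only [Function.comp, hH]
      rw [e, Real.rpow_neg hX.le]
      field_simp
    · exact (hder v hv0).continuousAt.continuousWithinAt
  have hint : IntegrableOn (fun v : ℝ => v * (1 - ((1 + X * v ^ (-T.α)) ^ T.N)⁻¹))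
      (Set.Ioc 0 ρ) := by
    refine intervalIntegral.integrableOn_deriv_of_nonneg hcont (fun v hv => hder v hv.1) ?_
    intro v hv
    have : 0 ≤ X * v ^ (-T.α) := mul_nonneg hX.le (Real.rpow_nonneg hv.1.le _)
    refine mul_nonneg hv.1.le (sub_nonneg.2 (inv_le_one_of_one_le₀ (one_le_pow₀ ?_)))
    linarith
  refine ⟨hint, ?_⟩
  rw [← intervalIntegral.integral_of_le hρ,
    intervalIntegral.integral_eq_sub_of_hasDerivAt_of_le hρ hcont (fun v hv => hder v hv.1)
      ((intervalIntegrable_iff_integrableOn_Ioc_of_le hρ).2 hint)]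
  simp [hH, Real.rpow_neg hρ, div_eq_mul_inv]

/-! ### The array gain -/

/-- The quotient sin(mθ) / sin θ is U_{m-1}(cos θ), a polynomial in cos θ with values ±m where sin θ
= 0. This removes the singularities and gives continuity and nonnegativity at once. -/
lemma gain_eq_chebyshev (ω : ℝ) : T.gain ω =
    ((Polynomial.Chebyshev.U ℝ ((T.ants : ℤ) - 1)).eval (Real.cos (Real.pi * ω)) / T.ants) ^ 2 := by
  have hN : (T.ants : ℝ) ≠ 0 := Nat.cast_ne_zero.2 T.ants_pos.ne'
  rw [gain]
  split_ifs with h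
  · have hc : Real.cos (Real.pi * ω) = 1 ∨ Real.cos (Real.pi * ω) = -1 :=
      Real.sin_eq_zero_iff_cos_eq.1 h
    rcases hc with hc | hc <;> rw [hc]
    · simp [hN]
    · rw [Polynomial.Chebyshev.U_eval_neg_one]
      push_cast
      rw [sub_add_cancel, mul_div_assoc, div_self hN, mul_one]
      rcases Int.even_or_odd ((T.ants : ℤ) - 1) with he | ho
      · simp [Int.negOnePow_even _ he]
      · simp [Int.negOnePow_odd _ ho]
  · have := Polynomial.Chebyshev.U_real_cos (Real.pi * ω) ((T.ants : ℤ) - 1)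
    push_cast at this
    rw [sub_add_cancel] at this
    rw [show Real.pi * T.ants * ω = T.ants * (Real.pi * ω) by ring, ← this]
    field_simp

lemma gain_nonneg (ω : ℝ) : 0 ≤ T.gain ω := by
  rw [gain_eq_chebyshev]
  positivity

lemma continuous_gain : Continuous T.gain := by
  have : T.gain = _ := funext T.gain_eq_chebyshev
  rw [this]
  refine ((Polynomial.continuous _).comp (by fun_prop)).div_const _ |>.pow 2

lemma eta_pos : 0 < T.eta :=
  mul_pos T.N_cast_pos (Real.rpow_pos_of_pos (Nat.cast_pos.2 (Nat.factorial_pos _)) _)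

lemma Z_nonneg (n : ℕ) (ω : ℝ) : 0 ≤ T.Z n ω :=
  div_nonneg (mul_nonneg (mul_nonneg n.cast_nonneg T.eta_pos.le) (T.gain_nonneg ω))
    (mul_nonneg T.G₀_pos.le T.N_cast_pos.le)

lemma continuous_Z (n : ℕ) : Continuous (T.Z n) :=
  (continuous_const.mul T.continuous_gain).div_const _

/-! ### `W_f` and `w_f` through the kernel -/

/-- `W_f` at `s = n η r^α / G₀`, through the kernel. -/
def WK (n : ℕ) (r ω t : ℝ) : ℝ :=
  T.R ^ 2 * T.discKernel (T.Z n ω * t * r ^ T.α / T.R ^ T.α)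
    - T.cacheProb * r ^ 2 * T.discKernel (T.Z n ω * t)

/-- `t ∂W_f/∂t` at `s = n η r^α / G₀`, through the kernel. -/
def wK (n : ℕ) (r ω t : ℝ) : ℝ :=
  T.R ^ 2 * T.discKernelDeriv (T.Z n ω * t * r ^ T.α / T.R ^ T.α)
    - T.cacheProb * r ^ 2 * T.discKernelDeriv (T.Z n ω * t)

lemma laplaceArg_eq (n : ℕ) (r ω t : ℝ) :
    n * T.eta * r ^ T.α / T.G₀ * T.gain ω * t / T.N = T.Z n ω * t * r ^ T.α := by
  rw [Z]
  have := T.G₀_pos.ne'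
  have := T.N_cast_pos.ne'
  field_simp

/-- The serving distance cancels from X / r^α = Z(ω) t, which requires r > 0. The right-hand side is
the form that stays continuous down to r = 0. -/
lemma W_eq (n : ℕ) {r t : ℝ} (hr : 0 < r) (ht : 0 < t) (ω : ℝ) :
    T.W r ω (n * T.eta * r ^ T.α / T.G₀) t = T.WK n r ω t := by
  have hR := T.R_pos
  have hZ := T.Z_nonneg n ω
  have hrα := Real.rpow_pos_of_pos hr T.α
  have hRα := Real.rpow_pos_of_pos hR T.α
  simp only [W, WK, ← div_div, laplaceArg_eq]
  have e : T.Z n ω * t * r ^ T.α / r ^ T.α = T.Z n ω * t := by field_simp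
  split_ifs with h h0
  · have : T.Z n ω * t = 0 := by
      rcases mul_eq_zero.1 h0 with h1 | h1
      · exact h1
      · exact absurd h1 hrα.ne'
    rw [h0, this, zero_div, discKernel_zero]
    ring
  · have h1 : 0 < T.Z n ω * t := by
      refine lt_of_le_of_ne (by positivity) fun h1 => h0 ?_
      rw [← h1, zero_mul]
    have h2 : 0 < T.Z n ω * t * r ^ T.α / T.R ^ T.α := by positivity
    rw [discKernel, if_pos h, if_neg (not_le.2 h2), discKernel, if_pos h, if_neg (not_le.2 h1)]
    have er : r ^ T.α = r ^ 2 := by rw [h, Real.rpow_two]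
    have eR : T.R ^ T.α = T.R ^ 2 := by rw [h, Real.rpow_two]
    rw [er] at e ⊢
    rw [eR, e]
    field_simp
  · have h1 : 0 ≤ T.Z n ω * t := by positivity
    have h2 : 0 ≤ T.Z n ω * t * r ^ T.α / T.R ^ T.α := by positivity
    rw [discKernel, if_neg h, discKernel, if_neg h, max_eq_left h1, max_eq_left h2, e,
      T.Delta_mul h1 hr.le]
    have e2 : T.Z n ω * t * r ^ T.α / T.R ^ T.α = T.Z n ω * t * (r / T.R) ^ T.α := by
      rw [Real.div_rpow hr.le hR.le, mul_div_assoc]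
    rw [show T.Delta (T.Z n ω * t * r ^ T.α / T.R ^ T.α) = T.Delta (T.Z n ω * t) * (r / T.R) ^ 2 by
      rw [e2, T.Delta_mul h1 (by positivity)]]
    field_simp
    ring

/-- For α = 2 the kernel is y F_y(y), so y K'(y) = y (F_y + y F_y'). -/
lemma mul_Fy_add {y : ℝ} (h : T.α = 2) (hy : 0 < y) :
    y * (T.Fy y + y * (((1 + y) ^ T.N)⁻¹ / y ^ 2)) = T.discKernelDeriv y := by
  rw [discKernelDeriv, discKernel, if_pos h, if_neg (not_le.2 hy), max_eq_left hy.le, h]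
  field_simp

lemma discKernelDeriv_eq {y : ℝ} (h : T.α ≠ 2) (hy : 0 ≤ y) : T.discKernelDeriv y =
    y * T.Lam y - 2 * T.N / (T.α - 2) * y * T.S 1 y := by
  have hs := T.S_zero_sub h hy
  have hα := T.α_pos
  have h1 : T.α - 2 ≠ 0 := sub_ne_zero.2 h
  rw [discKernelDeriv, discKernel, if_neg h, max_eq_left hy, T.mul_Lam hy]
  have : T.N / (1 - 2 / T.α) = T.α * T.N / (T.α - 2) := by
    rw [one_sub_div hα.ne', div_div_eq_mul_div, mul_comm]
  rw [this] at hs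
  have h2 : 2 * T.N / (T.α - 2) * y * T.S 1 y =
      2 / T.α * (T.S 0 y - ((1 + y) ^ T.N)⁻¹) := by
    rw [hs]
    field_simp
  rw [h2]
  ring

lemma w_eq (n : ℕ) {r t : ℝ} (hr : 0 < r) (ht : 0 < t) (ω : ℝ) :
    T.w n ω r t = T.wK n r ω t / t := by
  have hR := T.R_pos
  have hrα := Real.rpow_pos_of_pos hr T.α
  have hRα := Real.rpow_pos_of_pos hR T.α
  rcases (T.Z_nonneg n ω).eq_or_lt with h0 | hZ
  · simp [w, wK, ← h0, discKernelDeriv_zero]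
  have h1 : 0 < T.Z n ω * t := by positivity
  rw [w, wK]
  split_ifs with h
  · have er : r ^ T.α = r ^ 2 := by rw [h, Real.rpow_two]
    have eR : T.R ^ T.α = T.R ^ 2 := by rw [h, Real.rpow_two]
    have h2 : 0 < T.Z n ω * t * r ^ 2 / T.R ^ 2 := by positivity
    -- In both uses of f_y(y, z) the factor q z²/R² equals y: either z = r and y = Z t r²/R², or z =
    -- R and y = Z t. Hence f_y is F_y + y F_y'.
    rw [er, eR, ← T.mul_Fy_add h h1, ← T.mul_Fy_add h h2, fy, fy, T.fy_bracket h1,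
      T.fy_bracket h2, div_self (pow_pos hR 2).ne', ← mul_div_assoc]
    field_simp
  · have h2 : 0 < T.Z n ω * t * r ^ T.α / T.R ^ T.α := by positivity
    have e2 : T.Z n ω * t * r ^ T.α / T.R ^ T.α = T.Z n ω * t * (r / T.R) ^ T.α := by
      rw [Real.div_rpow hr.le hR.le, mul_div_assoc]
    have hΔ : T.Delta (T.Z n ω * t * r ^ T.α / T.R ^ T.α) =
        T.Delta (T.Z n ω * t) * (r / T.R) ^ 2 := by
      rw [e2, T.Delta_mul h1.le (by positivity)]
    rw [T.discKernelDeriv_eq h h1.le, T.discKernelDeriv_eq h h2.le, T.mul_Lam h2.le, hΔ,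
      Real.rpow_sub hR, Real.rpow_two]
    have hL := T.mul_Lam h1.le
    have hΔ' : T.Delta (T.Z n ω * t) = T.α / 2 * (T.Z n ω * t * T.Lam (T.Z n ω * t)) := by
      rw [hL]
      have := T.α_pos
      field_simp
    rw [hΔ']
    have h3 : T.α - 2 ≠ 0 := sub_ne_zero.2 h
    have := T.α_pos
    field_simp
    ring

lemma continuous_WK {X : Type*} [TopologicalSpace X] (n : ℕ) {r ω t : X → ℝ} (hr : Continuous r)
    (hω : Continuous ω) (ht : Continuous t) : Continuous fun x => T.WK n (r x) (ω x) (t x) := by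
  have h1 := T.continuous_discKernel
  have h2 := T.continuous_Z n
  have h3 : Continuous fun r : ℝ => r ^ T.α := Real.continuous_rpow_const T.α_pos.le
  unfold WK
  fun_prop

lemma continuous_wK {X : Type*} [TopologicalSpace X] (n : ℕ) {r ω t : X → ℝ} (hr : Continuous r)
    (hω : Continuous ω) (ht : Continuous t) : Continuous fun x => T.wK n (r x) (ω x) (t x) := by
  have h1 := T.continuous_discKernelDeriv
  have h2 := T.continuous_Z n
  have h3 : Continuous fun r : ℝ => r ^ T.α := Real.continuous_rpow_const T.α_pos.le
  unfold wK
  fun_prop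

lemma hasDerivAt_discKernel_mul {c t : ℝ} (hc : 0 ≤ c) (ht : 0 < t) :
    HasDerivAt (fun t => T.discKernel (c * t)) (T.discKernelDeriv (c * t) / t) t := by
  rcases hc.eq_or_lt with rfl | hc
  · simpa [discKernelDeriv_zero] using hasDerivAt_const t (T.discKernel 0)
  · have hct : 0 < c * t := by positivity
    have := HasDerivAt.comp t (T.hasDerivAt_discKernel hct) ((hasDerivAt_id t).const_mul c)
    convert! this using 1
    field_simp

lemma hasDerivAt_WK (n : ℕ) {r t : ℝ} (hr : 0 ≤ r) (ht : 0 < t) (ω : ℝ) :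
    HasDerivAt (fun t => T.WK n r ω t) (T.wK n r ω t / t) t := by
  have hZ := T.Z_nonneg n ω
  have hc : 0 ≤ T.Z n ω * (r ^ T.α / T.R ^ T.α) :=
    mul_nonneg hZ (div_nonneg (Real.rpow_nonneg hr _) (Real.rpow_nonneg T.R_pos.le _))
  have e : ∀ t, T.Z n ω * t * r ^ T.α / T.R ^ T.α = T.Z n ω * (r ^ T.α / T.R ^ T.α) * t :=
    fun t => by ring
  have := ((T.hasDerivAt_discKernel_mul hc ht).const_mul (T.R ^ 2)).sub
    ((T.hasDerivAt_discKernel_mul hZ ht).const_mul (T.cacheProb * r ^ 2))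
  simp only [WK, wK, e]
  convert! this using 1
  ring

end PicoTier

/-! ### Gauss-Chebyshev quadrature -/

/-- The Gauss-Chebyshev sum of order `u` for `∫ x in -1..1, f x`. -/
def chebQuad (u : ℕ) (f : ℝ → ℝ) : ℝ :=
  Real.pi / u * ∑ k ∈ Finset.Icc 1 u, f (chebNode u k) * Real.sqrt (1 - chebNode u k ^ 2)

/-- Midpoint of the `j`-th of `u` equal cells of `[0, π]`. -/
def cellMid (u j : ℕ) : ℝ := (2 * (j : ℝ) + 1) / (2 * u) * Real.pi

/-- The nodes are the cosines of the midpoints of u equal cells of [0, π], and √(1 - x²) is the sine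
there: a midpoint rule for f(cos θ) sin θ. -/
lemma chebQuad_eq_sum_range (u : ℕ) (f : ℝ → ℝ) :
    chebQuad u f = ∑ j ∈ Finset.range u,
      Real.pi / u * (f (Real.cos (cellMid u j)) * Real.sin (cellMid u j)) := by
  rw [chebQuad, Finset.mul_sum]
  refine (Finset.sum_nbij' (fun j => j + 1) (fun k => k - 1) ?_ ?_ ?_ ?_ ?_).symm
  · intro j hj
    simp only [Finset.mem_range, Finset.mem_Icc] at hj ⊢
    omega
  · intro k hk
    simp only [Finset.mem_range, Finset.mem_Icc] at hk ⊢
    omega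
  · intro j _
    rfl
  · intro k hk
    exact Nat.sub_add_cancel (Finset.mem_Icc.1 hk).1
  · intro j hj
    have hj : ((j : ℝ) + 1) ≤ u := by exact_mod_cast Finset.mem_range.1 hj
    have hj0 : (0 : ℝ) ≤ j := j.cast_nonneg
    have hnode : chebNode u (j + 1) = Real.cos (cellMid u j) := by
      rw [chebNode, cellMid]
      congr 3
      push_cast
      ring
    have hsin : 0 ≤ Real.sin (cellMid u j) := by
      refine Real.sin_nonneg_of_nonneg_of_le_pi (mul_nonneg (by positivity) Real.pi_pos.le) ?_
      refine mul_le_of_le_one_left Real.pi_pos.le ?_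
      rw [div_le_one (by linarith)]
      linarith
    rw [hnode, ← Real.abs_sin_eq_sqrt_one_sub_cos_sq, abs_of_nonneg hsin]

lemma integral_eq_integral_cos {f : ℝ → ℝ} (hf : Continuous f) :
    ∫ x in (-1 : ℝ)..1, f x = ∫ θ in (0 : ℝ)..Real.pi, f (Real.cos θ) * Real.sin θ := by
  have := intervalIntegral.integral_comp_mul_deriv (a := 0) (b := Real.pi) (f := Real.cos)
    (f' := fun θ => -Real.sin θ) (g := f) (fun θ _ => Real.hasDerivAt_cos θ)
    (by fun_prop) hf
  simp only [Function.comp, Real.cos_zero, Real.cos_pi, mul_neg,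
    intervalIntegral.integral_neg] at this
  rw [intervalIntegral.integral_symm, ← this, neg_neg]

/-- Gauss-Chebyshev sums of a family of functions that converges continuously to `f` converge to the
integral of `f`. -/
lemma tendsto_chebQuad {ι : Type*} {l : Filter ι} {F : ι → ℝ → ℝ} {f : ℝ → ℝ} (hf : Continuous f)
    (hF : ∀ x, Tendsto (fun q : ι × ℝ => F q.1 q.2) (l ×ˢ 𝓝 x) (𝓝 (f x))) {u : ι → ℕ}
    (hu : Tendsto u l atTop) :
    Tendsto (fun i => chebQuad (u i) (F i)) l (𝓝 (∫ x in (-1 : ℝ)..1, f x)) := by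
  -- Continuous convergence to a continuous limit is locally uniform, hence uniform on the compact
  -- interval.
  have hunif : TendstoUniformlyOn F f l (Set.Icc (-1) 1) := by
    rw [← tendstoLocallyUniformlyOn_iff_tendstoUniformlyOn_of_compact isCompact_Icc]
    refine TendstoLocallyUniformly.tendstoLocallyUniformlyOn ?_
    rw [tendstoLocallyUniformly_iff_forall_tendsto]
    intro x
    have h1 : Tendsto (fun q : ι × ℝ => (f q.2, F q.1 q.2)) (l ×ˢ 𝓝 x) (𝓝 (f x, f x)) :=
      ((hf.tendsto x).comp tendsto_snd).prodMk_nhds (hF x)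
    exact h1.mono_right (nhds_le_uniformity _)
  rw [integral_eq_integral_cos hf]
  set h : ℝ → ℝ := fun θ => f (Real.cos θ) * Real.sin θ with hh
  have hc : Continuous h := by fun_prop
  have huc : UniformContinuousOn h (Set.Icc 0 Real.pi) :=
    isCompact_Icc.uniformContinuousOn_of_continuous hc.continuousOn
  rw [Metric.tendsto_nhds]
  intro ε hε
  have hπ := Real.pi_pos
  -- Two errors of size ε/(4π), one from replacing F by f and one from the oscillation of h on a
  -- cell, add up over length π to ε/2.
  obtain ⟨δ, hδ, hδ'⟩ := Metric.uniformContinuousOn_iff.1 huc (ε / (4 * Real.pi)) (by positivity)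
  obtain ⟨u₀, hu₀⟩ := exists_nat_gt (Real.pi / δ)
  filter_upwards [Metric.tendstoUniformlyOn_iff.1 hunif (ε / (4 * Real.pi)) (by positivity),
    hu.eventually_ge_atTop (u₀ + 1)] with i hi hui
  set n := u i with hn
  have hn0 : (0 : ℝ) < n := Nat.cast_pos.2 (by omega)
  have hnδ : Real.pi / n < δ := by
    rw [div_lt_iff₀ hn0]
    rw [div_lt_iff₀ hδ] at hu₀
    have : (u₀ : ℝ) < n := Nat.cast_lt.2 (by omega)
    nlinarith
  have hsplit : ∫ θ in (0 : ℝ)..Real.pi, h θ =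
      ∑ j ∈ Finset.range n, ∫ θ in (j * (Real.pi / n))..((j + 1 : ℕ) * (Real.pi / n)), h θ := by
    rw [intervalIntegral.sum_integral_adjacent_intervals (a := fun j : ℕ => j * (Real.pi / n))
      fun k _ => hc.intervalIntegrable _ _]
    congr 1
    · simp
    · field_simp
  rw [dist_eq_norm, chebQuad_eq_sum_range, hsplit, ← Finset.sum_sub_distrib]
  have hcell : ∀ j ∈ Finset.range n,
      ‖Real.pi / n * (F i (Real.cos (cellMid n j)) * Real.sin (cellMid n j)) -
        ∫ θ in (j * (Real.pi / n))..((j + 1 : ℕ) * (Real.pi / n)), h θ‖ ≤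
      ε / (2 * Real.pi) * (Real.pi / n) := by
    intro j hj
    have hj : ((j : ℝ) + 1) ≤ n := by exact_mod_cast Finset.mem_range.1 hj
    have hj0 : (0 : ℝ) ≤ j := j.cast_nonneg
    set s := Real.pi / n with hs
    have hs0 : 0 < s := by positivity
    have hns : n * s = Real.pi := by rw [hs]; field_simp
    have hmid : cellMid n j = j * s + s / 2 := by
      rw [cellMid, hs]
      field_simp
    have hmem : ∀ θ ∈ Set.Icc (j * s) ((j + 1 : ℕ) * s), θ ∈ Set.Icc 0 Real.pi := by
      intro θ hθ
      push_cast at hθ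
      refine ⟨le_trans (by positivity) hθ.1, hθ.2.trans ?_⟩
      rw [← hns]
      gcongr
    have hmidm : cellMid n j ∈ Set.Icc (j * s) ((j + 1 : ℕ) * s) := by
      push_cast
      rw [hmid]
      constructor <;> linarith
    have hconst : s * (F i (Real.cos (cellMid n j)) * Real.sin (cellMid n j)) =
        ∫ θ in (j * s)..((j + 1 : ℕ) * s),
          F i (Real.cos (cellMid n j)) * Real.sin (cellMid n j) := by
      rw [intervalIntegral.integral_const, smul_eq_mul]
      push_cast
      ring
    rw [hconst, ← intervalIntegral.integral_sub (continuous_const.intervalIntegrable _ _)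
      (hc.intervalIntegrable _ _)]
    have hle : (j : ℝ) * s ≤ (j + 1 : ℕ) * s := by
      push_cast
      linarith
    have hlen : |((j + 1 : ℕ) : ℝ) * s - j * s| = s := by
      push_cast
      rw [add_mul, one_mul, add_sub_cancel_left, abs_of_pos hs0]
    rw [show ε / (2 * Real.pi) * s =
      ε / (2 * Real.pi) * |((j + 1 : ℕ) : ℝ) * s - j * s| by rw [hlen]]
    apply intervalIntegral.norm_integral_le_of_norm_le_const
    intro θ hθ
    rw [Set.uIoc_of_le hle] at hθ
    have hθ' := Set.Ioc_subset_Icc_self hθ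
    have hd : dist (cellMid n j) θ < δ := by
      refine lt_of_le_of_lt ?_ hnδ
      rw [Real.dist_eq, abs_le]
      push_cast at hθ' hmidm
      constructor <;> linarith [hθ'.1, hθ'.2, hmidm.1, hmidm.2]
    have h1 := hδ' _ (hmem _ hmidm) _ (hmem _ hθ') hd
    have h2 := hi (Real.cos (cellMid n j)) ⟨Real.neg_one_le_cos _, Real.cos_le_one _⟩
    have h3 := Real.abs_sin_le_one (cellMid n j)
    rw [Real.dist_eq] at h1 h2
    have e : F i (Real.cos (cellMid n j)) * Real.sin (cellMid n j) - h θ =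
        -(f (Real.cos (cellMid n j)) - F i (Real.cos (cellMid n j))) * Real.sin (cellMid n j) +
          (h (cellMid n j) - h θ) := by
      simp only [hh]
      ring
    rw [e]
    refine (norm_add_le _ _).trans ?_
    rw [norm_mul, norm_neg, Real.norm_eq_abs, Real.norm_eq_abs, Real.norm_eq_abs]
    have h4 : |f (Real.cos (cellMid n j)) - F i (Real.cos (cellMid n j))| *
        |Real.sin (cellMid n j)| ≤ ε / (4 * Real.pi) * 1 := by gcongr
    have h5 : ε / (2 * Real.pi) = ε / (4 * Real.pi) * 1 + ε / (4 * Real.pi) := by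
      field_simp
      norm_num
    linarith
  refine (norm_sum_le_of_le _ hcell).trans_lt ?_
  rw [Finset.sum_const, Finset.card_range, nsmul_eq_mul]
  have : n * (ε / (2 * Real.pi) * (Real.pi / n)) = ε / 2 := by field_simp
  rw [this]
  linarith

/-! ### Differentiation under the integral sign -/

/-- The derivative is taken in the form g/t with g continuous at t = 0 as well, matching y K'(y).
Compactness of [τ/2, 2τ] × [a, b] bounds g, and t > τ/2 then bounds the quotient. -/
lemma hasDerivAt_intervalIntegral_of_continuous {f g : ℝ → ℝ → ℝ} {a b τ : ℝ} (hab : a ≤ b)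
    (hτ : 0 < τ)
    (hf : Continuous fun q : ℝ × ℝ => f q.1 q.2) (hg : Continuous fun q : ℝ × ℝ => g q.1 q.2)
    (hd : ∀ t, 0 < t → ∀ x ∈ Set.Icc a b, HasDerivAt (fun t => f t x) (g t x / t) t) :
    HasDerivAt (fun t => ∫ x in a..b, f t x) ((∫ x in a..b, g τ x) / τ) τ := by
  obtain ⟨C, hC⟩ := (isCompact_Icc.prod isCompact_Icc :
    IsCompact (Set.Icc (τ / 2) (2 * τ) ×ˢ Set.Icc a b)).exists_bound_of_continuousOn
    hg.continuousOn
  have hnhds : Set.Ioo (τ / 2) (2 * τ) ∈ 𝓝 τ := Ioo_mem_nhds (by linarith) (by linarith)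
  have hft : ∀ t, Continuous (f t) := fun t => by
    have : f t = (fun q : ℝ × ℝ => f q.1 q.2) ∘ fun x => (t, x) := rfl
    rw [this]
    fun_prop
  have hgt : ∀ t, Continuous (g t) := fun t => by
    have : g t = (fun q : ℝ × ℝ => g q.1 q.2) ∘ fun x => (t, x) := rfl
    rw [this]
    fun_prop
  have := (intervalIntegral.hasDerivAt_integral_of_dominated_loc_of_deriv_le
    (F := f) (F' := fun t x => g t x / t) (bound := fun _ => C / (τ / 2)) (μ := volume)
    (a := a) (b := b) (x₀ := τ) hnhds
    (Eventually.of_forall fun t => (hft t).aestronglyMeasurable)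
    ((hft τ).intervalIntegrable _ _) ((hgt τ).div_const τ).aestronglyMeasurable
    (Eventually.of_forall fun x hx t ht => ?_) intervalIntegrable_const
    (Eventually.of_forall fun x hx t ht => ?_)).2
  · rwa [intervalIntegral.integral_div] at this
  · rw [Set.uIoc_of_le hab] at hx
    have h1 := hC (t, x) ⟨Set.Ioo_subset_Icc_self ht, Set.Ioc_subset_Icc_self hx⟩
    have ht0 : τ / 2 < t := ht.1
    have : 0 < t := by linarith
    rw [norm_div, Real.norm_of_nonneg this.le]
    have hC0 : 0 ≤ C := (norm_nonneg _).trans h1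
    exact div_le_div₀ hC0 h1 (by positivity) ht0.le
  · rw [Set.uIoc_of_le hab] at hx
    exact hd t (by linarith [ht.1]) x (Set.Ioc_subset_Icc_self hx)

lemma continuous_intervalIntegral {X : Type*} [TopologicalSpace X] {f : X → ℝ → ℝ}
    (hf : Continuous fun q : X × ℝ => f q.1 q.2) (a b : ℝ) :
    Continuous fun t => ∫ x in a..b, f t x :=
  intervalIntegral.continuous_parametric_intervalIntegral_of_continuous' hf a b

/-! ### The Laplace functional of a Poisson process -/

lemma measurable_natCast_ennreal : Measurable fun k : ℕ => (k : ℝ≥0∞) :=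
  measurable_of_countable _

namespace IsPoissonProcess

variable {Ω E : Type*} [MeasurableSpace Ω] [MeasurableSpace E] {Φ : Ω → Measure E} {Λ : Measure E}
  {μ : Measure Ω}

lemma measurable_apply (hΦ : IsPoissonProcess Φ Λ μ) {B : Set E} (hB : MeasurableSet B) :
    Measurable fun ω => Φ ω B :=
  (Measure.measurable_coe hB).comp hΦ.measurable

lemma ae_lt_top (hΦ : IsPoissonProcess Φ Λ μ) {B : Set E} (hB : MeasurableSet B) (h : Λ B ≠ ∞) :
    ∀ᵐ ω ∂μ, Φ ω B < ∞ := by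
  have h1 : μ.map (fun ω => Φ ω B) {∞} = 0 := by
    rw [hΦ.law B hB h, Measure.map_apply measurable_natCast_ennreal (measurableSet_singleton _)]
    have : (fun k : ℕ => (k : ℝ≥0∞)) ⁻¹' {∞} = ∅ := by
      ext k
      simp
    rw [this, measure_empty]
  rw [Measure.map_apply (hΦ.measurable_apply hB) (measurableSet_singleton _)] at h1
  filter_upwards [measure_eq_zero_iff_ae_notMem.1 h1] with ω hω
  exact lt_top_iff_ne_top.2 hω

lemma measure_eq_zero (hΦ : IsPoissonProcess Φ Λ μ) {B : Set E} (hB : MeasurableSet B)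
    (h : Λ B ≠ ∞) : μ {ω | Φ ω B = 0} = ENNReal.ofReal (Real.exp (-(Λ B).toReal)) := by
  have h1 : μ.map (fun ω => Φ ω B) {0} = ENNReal.ofReal (Real.exp (-(Λ B).toReal)) := by
    rw [hΦ.law B hB h, Measure.map_apply measurable_natCast_ennreal (measurableSet_singleton _)]
    have : (fun k : ℕ => (k : ℝ≥0∞)) ⁻¹' {0} = {0} := by
      ext k
      simp
    rw [this, poissonMeasure_singleton]
    simp [ENNReal.coe_toNNReal_eq_toReal]
  rwa [Measure.map_apply (hΦ.measurable_apply hB) (measurableSet_singleton _)] at h1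

lemma integral_exp_neg_mul (hΦ : IsPoissonProcess Φ Λ μ) {B : Set E} (hB : MeasurableSet B)
    (h : Λ B ≠ ∞) (c : ℝ) : ∫ ω, Real.exp (-(c * (Φ ω B).toReal)) ∂μ =
      Real.exp (-((1 - Real.exp (-c)) * (Λ B).toReal)) := by
  have hm : Measurable fun x : ℝ≥0∞ => Real.exp (-(c * x.toReal)) := by fun_prop
  have h1 := integral_map (μ := μ) (hΦ.measurable_apply hB).aemeasurable
    (f := fun x : ℝ≥0∞ => Real.exp (-(c * x.toReal))) hm.aestronglyMeasurable
  rw [← h1, hΦ.law B hB h, integral_map measurable_natCast_ennreal.aemeasurable hm.aestronglyMeasurable,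
    integral_poissonMeasure]
  set a := (Λ B).toReal with ha
  have h2 : ((Λ B).toNNReal : ℝ) = a := rfl
  have h3 := NormedSpace.expSeries_div_hasSum_exp (𝔸 := ℝ) (a * Real.exp (-c))
  rw [← Real.exp_eq_exp_ℝ] at h3
  have h4 := h3.mul_left (Real.exp (-a))
  have h5 : (fun n : ℕ => (Real.exp (-((Λ B).toNNReal : ℝ)) * ((Λ B).toNNReal : ℝ) ^ n /
      n.factorial) • Real.exp (-(c * ((n : ℝ≥0∞)).toReal))) =
      fun n : ℕ => Real.exp (-a) * ((a * Real.exp (-c)) ^ n / n.factorial) := by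
    funext n
    rw [h2, ENNReal.toReal_natCast, mul_pow, ← Real.exp_nat_mul, smul_eq_mul,
      show (n : ℝ) * -c = -(c * n) by ring]
    ring
  rw [h5, h4.tsum_eq, ← Real.exp_add]
  congr 1
  ring

/-- Campbell's formula is of no use here: the received power may be unbounded with infinite mean, as
r^(-α) with α ≥ 2 is not integrable at the origin of the plane. Instead the sets {f > K} lie in S
and decrease to ∅, so their void probabilities tend to 1. Almost surely one of them carries no
points, and then the integral is at most K Φ(S) < ∞. -/
lemma ae_lintegral_lt_top [IsProbabilityMeasure μ] (hΦ : IsPoissonProcess Φ Λ μ) {f : E → ℝ≥0∞} (hf : Measurable f)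
    (hfin : ∀ x, f x ≠ ∞) {S : Set E} (hS : MeasurableSet S) (hSΛ : Λ S ≠ ∞)
    (hfS : ∀ x, x ∉ S → f x = 0) : ∀ᵐ ω ∂μ, ∫⁻ x, f x ∂(Φ ω) < ∞ := by
  set A : ℕ → Set E := fun K => {x | (K : ℝ≥0∞) < f x} with hA
  have hAm : ∀ K, MeasurableSet (A K) := fun K => measurableSet_lt measurable_const hf
  have hAS : ∀ K, A K ⊆ S := by
    intro K x hx
    by_contra hcon
    simp [hA, hfS x hcon] at hx
  have hAfin : ∀ K, Λ (A K) ≠ ∞ := fun K => ne_top_of_le_ne_top hSΛ (measure_mono (hAS K))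
  have hinter : ⋂ K, A K = ∅ := by
    refine Set.eq_empty_of_forall_notMem fun x hx => ?_
    obtain ⟨K, hK⟩ := ENNReal.exists_nat_gt (hfin x)
    exact lt_asymm hK (Set.mem_iInter.1 hx K)
  have hanti : Antitone A := fun K K' hKK x (hx : (K' : ℝ≥0∞) < f x) =>
    lt_of_le_of_lt (Nat.cast_le.2 hKK) hx
  have hlim : Tendsto (fun K => Λ (A K)) atTop (𝓝 0) := by
    have := tendsto_measure_iInter_atTop (fun K => (hAm K).nullMeasurableSet) hanti
      ⟨0, hAfin 0⟩
    rwa [hinter, measure_empty] at this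
  have hlim2 : Tendsto (fun K => 1 - ENNReal.ofReal (Real.exp (-(Λ (A K)).toReal))) atTop
      (𝓝 0) := by
    have h1 := (ENNReal.tendsto_toReal ENNReal.zero_ne_top).comp hlim
    have h2 := ENNReal.tendsto_ofReal ((Real.continuous_exp.tendsto _).comp h1.neg)
    have h3 := ENNReal.Tendsto.sub (tendsto_const_nhds (x := (1 : ℝ≥0∞)) (f := atTop)) h2
      (Or.inl ENNReal.one_ne_top)
    simpa using h3
  have hnull : μ (⋂ K, {ω | Φ ω (A K) = 0}ᶜ) = 0 := by
    refine le_antisymm (ge_of_tendsto' hlim2 fun K => ?_) zero_le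
    refine (measure_mono (Set.iInter_subset _ K)).trans ?_
    have hm : MeasurableSet {ω | Φ ω (A K) = 0} :=
      hΦ.measurable_apply (hAm K) (measurableSet_singleton 0)
    rw [prob_compl_eq_one_sub hm, hΦ.measure_eq_zero (hAm K) (hAfin K)]
  filter_upwards [measure_eq_zero_iff_ae_notMem.1 hnull, hΦ.ae_lt_top hS hSΛ] with ω h1 h2
  obtain ⟨K, hK⟩ : ∃ K, Φ ω (A K) = 0 := by
    simpa using h1
  have h3 : ∀ᵐ x ∂(Φ ω), f x ≤ S.indicator (fun _ => (K : ℝ≥0∞)) x := by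
    filter_upwards [measure_eq_zero_iff_ae_notMem.1 hK] with x hx
    by_cases hxS : x ∈ S
    · rw [Set.indicator_of_mem hxS]
      exact not_lt.1 hx
    · rw [hfS x hxS]
      exact zero_le
  refine (lintegral_mono_ae h3).trans_lt ?_
  rw [lintegral_indicator_const hS]
  exact ENNReal.mul_lt_top (ENNReal.natCast_lt_top K) h2

/-- The level sets of the nonzero values are disjoint subsets of S, so their counts are independent
Poisson variables with finite means and the transform factorises. -/
lemma integral_exp_neg_lintegral_simpleFunc (hΦ : IsPoissonProcess Φ Λ μ)
    (f : SimpleFunc E ℝ≥0∞) (hfin : ∀ x, f x ≠ ∞) {S : Set E} (hSΛ : Λ S ≠ ∞)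
    (hfS : ∀ x, x ∉ S → f x = 0) : ∫ ω, Real.exp (-(∫⁻ x, f x ∂(Φ ω)).toReal) ∂μ =
      Real.exp (-∫ x, (1 - Real.exp (-(f x).toReal)) ∂Λ) := by
  classical
  set s : Finset ℝ≥0∞ := f.range.filter (· ≠ 0) with hs
  set e := s.equivFin with he
  set c : Fin s.card → ℝ≥0∞ := fun i => e.symm i with hc
  set B : Fin s.card → Set E := fun i => f ⁻¹' {c i} with hB
  have hBm : ∀ i, MeasurableSet (B i) := fun i => f.measurableSet_preimage _
  have hc0 : ∀ i, c i ≠ 0 := fun i => (Finset.mem_filter.1 (e.symm i).2).2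
  have hctop : ∀ i, c i ≠ ∞ := by
    intro i
    obtain ⟨x, hx⟩ := SimpleFunc.mem_range.1 (Finset.mem_filter.1 (e.symm i).2).1
    rw [hc]
    simp only
    rw [← hx]
    exact hfin x
  have hBS : ∀ i, B i ⊆ S := by
    intro i x hx
    by_contra hcon
    have h1 : f x = c i := hx
    rw [hfS x hcon] at h1
    exact hc0 i h1.symm
  have hBfin : ∀ i, Λ (B i) ≠ ∞ := fun i => ne_top_of_le_ne_top hSΛ (measure_mono (hBS i))
  have hBd : Pairwise fun i j => Disjoint (B i) (B j) := by
    intro i j hij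
    refine Set.disjoint_left.2 fun x hx hx' => hij ?_
    have h1 : f x = c i := hx
    have h2 : f x = c j := hx'
    exact e.symm.injective (Subtype.ext (h1.symm.trans h2))
  have hli : ∀ m : Measure E, ∫⁻ x, f x ∂m = ∑ i, c i * m (B i) := by
    intro m
    rw [SimpleFunc.lintegral_eq_lintegral, SimpleFunc.lintegral,
      Equiv.sum_comp e.symm fun c : s => (c : ℝ≥0∞) * m (f ⁻¹' {(c : ℝ≥0∞)}),
      Finset.sum_coe_sort s fun c => c * m (f ⁻¹' {c}), hs, Finset.sum_filter_of_ne]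
    intro c _ hc hc0
    exact hc (by rw [hc0, zero_mul])
  have hri : ∀ x, 1 - Real.exp (-(f x).toReal) =
      ∑ i, (B i).indicator (fun _ => 1 - Real.exp (-(c i).toReal)) x := by
    intro x
    by_cases hx : f x = 0
    · rw [Finset.sum_eq_zero]
      · simp [hx]
      · intro i _
        refine Set.indicator_of_notMem (fun h1 => ?_) _
        have h1 : f x = c i := h1
        exact hc0 i (h1.symm.trans hx)
    · have hxs : f x ∈ s := Finset.mem_filter.2 ⟨f.mem_range_self x, hx⟩
      have hci : c (e ⟨f x, hxs⟩) = f x := by simp [hc]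
      rw [Finset.sum_eq_single (e ⟨f x, hxs⟩)]
      · rw [Set.indicator_of_mem (show x ∈ B (e ⟨f x, hxs⟩) from hci.symm), hci]
      · intro i _ hi
        refine Set.indicator_of_notMem (fun h1 => hi ?_) _
        have h1 : f x = c i := h1
        rw [← e.apply_symm_apply i]
        exact congrArg e (Subtype.ext h1.symm)
      · simp
  have hR : ∫ x, (1 - Real.exp (-(f x).toReal)) ∂Λ =
      ∑ i, (1 - Real.exp (-(c i).toReal)) * (Λ (B i)).toReal := by
    simp_rw [hri]
    rw [integral_finsetSum]
    · refine Finset.sum_congr rfl fun i _ => ?_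
      rw [integral_indicator_const _ (hBm i), smul_eq_mul, mul_comm, measureReal_def]
    · intro i _
      exact (integrable_indicator_iff (hBm i)).2 (integrableOn_const (hBfin i))
  set X : Fin s.card → Ω → ℝ := fun i ω => -((c i).toReal * (Φ ω (B i)).toReal) with hX
  have hXm : ∀ i, Measurable (X i) := fun i =>
    ((hΦ.measurable_apply (hBm i)).ennreal_toReal.const_mul _).neg
  have hXi : iIndepFun X μ :=
    (hΦ.indep s.card B hBm hBd).comp (fun i x => -((c i).toReal * x.toReal))
      fun i => by fun_prop
  have hmgf := hXi.mgf_sum hXm Finset.univ (t := 1)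
  have hL : ∫ ω, Real.exp (-(∫⁻ x, f x ∂(Φ ω)).toReal) ∂μ = mgf (∑ i, X i) μ 1 := by
    refine integral_congr_ae ?_
    filter_upwards [ae_all_iff.2 fun i => hΦ.ae_lt_top (hBm i) (hBfin i)] with ω hω
    rw [hli, ENNReal.toReal_sum fun i _ => ENNReal.mul_ne_top (hctop i) (hω i).ne]
    simp [hX, ENNReal.toReal_mul, Finset.sum_neg_distrib]
  rw [hL, hmgf, hR, ← Finset.sum_neg_distrib, Real.exp_sum]
  refine Finset.prod_congr rfl fun i _ => ?_
  rw [← hΦ.integral_exp_neg_mul (hBm i) (hBfin i) (c i).toReal, mgf]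
  simp [hX]

/-- The Laplace functional of a Poisson process at a function supported on a set of finite
intensity. -/
lemma integral_exp_neg_lintegral [IsProbabilityMeasure μ] (hΦ : IsPoissonProcess Φ Λ μ)
    {f : E → ℝ≥0∞} (hf : Measurable f) (hfin : ∀ x, f x ≠ ∞) {S : Set E} (hS : MeasurableSet S)
    (hSΛ : Λ S ≠ ∞) (hfS : ∀ x, x ∉ S → f x = 0) :
    ∫ ω, Real.exp (-(∫⁻ x, f x ∂(Φ ω)).toReal) ∂μ =
      Real.exp (-∫ x, (1 - Real.exp (-(f x).toReal)) ∂Λ) := by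
  set g := SimpleFunc.eapprox f with hg
  have hle : ∀ n x, g n x ≤ f x := fun n x => by
    rw [← SimpleFunc.iSup_eapprox_apply hf x]
    exact le_iSup (fun n => SimpleFunc.eapprox f n x) n
  have hgS : ∀ n x, x ∉ S → g n x = 0 := fun n x hx => by
    have := hle n x
    rw [hfS x hx] at this
    exact nonpos_iff_eq_zero.1 this
  have hgt : ∀ x, Tendsto (fun n => (g n x).toReal) atTop (𝓝 (f x).toReal) := fun x =>
    (ENNReal.tendsto_toReal (hfin x)).comp (SimpleFunc.tendsto_eapprox hf x)
  have key : ∀ n, ∫ ω, Real.exp (-(∫⁻ x, g n x ∂(Φ ω)).toReal) ∂μ =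
      Real.exp (-∫ x, (1 - Real.exp (-(g n x).toReal)) ∂Λ) := fun n =>
    hΦ.integral_exp_neg_lintegral_simpleFunc (g n) (fun x => ne_top_of_le_ne_top (hfin x) (hle n x))
      hSΛ (hgS n)
  have hL : Tendsto (fun n => ∫ ω, Real.exp (-(∫⁻ x, g n x ∂(Φ ω)).toReal) ∂μ) atTop
      (𝓝 (∫ ω, Real.exp (-(∫⁻ x, f x ∂(Φ ω)).toReal) ∂μ)) := by
    refine tendsto_integral_of_dominated_convergence (fun _ => 1) (fun n => ?_)
      (integrable_const 1) (fun n => Eventually.of_forall fun ω => ?_) ?_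
    · exact (Real.measurable_exp.comp (((Measure.measurable_lintegral
        (g n).measurable).comp hΦ.measurable).ennreal_toReal.neg)).aestronglyMeasurable
    · rw [Real.norm_of_nonneg (Real.exp_pos _).le, Real.exp_le_one_iff]
      simp
    -- Almost sure finiteness is needed because `ENNReal.toReal` sends ∞ to 0 and is not continuous
    -- there.
    · filter_upwards [hΦ.ae_lintegral_lt_top hf hfin hS hSΛ hfS] with ω hω
      refine (Real.continuous_exp.tendsto _).comp (Tendsto.neg ?_)
      refine (ENNReal.tendsto_toReal hω.ne).comp ?_
      exact lintegral_tendsto_of_tendsto_of_monotone (fun n => (g n).measurable.aemeasurable)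
        (Eventually.of_forall fun x => fun m n hmn => SimpleFunc.monotone_eapprox f hmn x)
        (Eventually.of_forall fun x => SimpleFunc.tendsto_eapprox hf x)
  have hRt : Tendsto (fun n => ∫ x, (1 - Real.exp (-(g n x).toReal)) ∂Λ) atTop
      (𝓝 (∫ x, (1 - Real.exp (-(f x).toReal)) ∂Λ)) := by
    -- The integrands vanish off S and are bounded by 1, and S has finite intensity.
    refine tendsto_integral_of_dominated_convergence (S.indicator fun _ => 1) (fun n => ?_)
      ((integrable_indicator_iff hS).2 (integrableOn_const hSΛ))
      (fun n => Eventually.of_forall fun x => ?_) (Eventually.of_forall fun x => ?_)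
    · exact (measurable_const.sub (Real.measurable_exp.comp
        (g n).measurable.ennreal_toReal.neg)).aestronglyMeasurable
    · by_cases hx : x ∈ S
      · rw [Set.indicator_of_mem hx, Real.norm_eq_abs, abs_le]
        have h1 := Real.exp_pos (-(g n x).toReal)
        have h2 : Real.exp (-(g n x).toReal) ≤ 1 := by
          rw [Real.exp_le_one_iff]
          simp
        constructor <;> linarith
      · simp [hgS n x hx, hx]
    · exact ((Real.continuous_exp.tendsto _).comp (hgt x).neg).const_sub 1
  have hRt' := (Real.continuous_exp.tendsto _).comp hRt.neg
  refine tendsto_nhds_unique hL (hRt'.congr fun n => ?_)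
  exact (key n).symm

/-- The joint Laplace functional of two independent Poisson processes. -/
lemma integral_exp_neg_add [IsProbabilityMeasure μ] {Φ' : Ω → Measure E} {Λ' : Measure E}
    (hΦ : IsPoissonProcess Φ Λ μ) (hΦ' : IsPoissonProcess Φ' Λ' μ) (hind : IndepFun Φ Φ' μ)
    {f f' : E → ℝ≥0∞} (hf : Measurable f) (hf' : Measurable f')
    (hfin : ∀ x, f x ≠ ∞) (hfin' : ∀ x, f' x ≠ ∞) {S : Set E} (hS : MeasurableSet S)
    (hSΛ : Λ S ≠ ∞) (hSΛ' : Λ' S ≠ ∞) (hfS : ∀ x, x ∉ S → f x = 0)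
    (hfS' : ∀ x, x ∉ S → f' x = 0) :
    ∫ ω, Real.exp (-(∫⁻ x, f x ∂(Φ ω) + ∫⁻ x, f' x ∂(Φ' ω)).toReal) ∂μ =
      Real.exp (-(∫ x, (1 - Real.exp (-(f x).toReal)) ∂Λ +
        ∫ x, (1 - Real.exp (-(f' x).toReal)) ∂Λ')) := by
  have hm : ∀ {f : E → ℝ≥0∞}, Measurable f →
      Measurable fun m : Measure E => Real.exp (-(∫⁻ x, f x ∂m).toReal) := fun h =>
    Real.measurable_exp.comp (Measure.measurable_lintegral h).ennreal_toReal.neg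
  have h1 : ∫ ω, Real.exp (-(∫⁻ x, f x ∂(Φ ω) + ∫⁻ x, f' x ∂(Φ' ω)).toReal) ∂μ =
      ∫ ω, Real.exp (-(∫⁻ x, f x ∂(Φ ω)).toReal) * Real.exp (-(∫⁻ x, f' x ∂(Φ' ω)).toReal) ∂μ := by
    refine integral_congr_ae ?_
    filter_upwards [hΦ.ae_lintegral_lt_top hf hfin hS hSΛ hfS,
      hΦ'.ae_lintegral_lt_top hf' hfin' hS hSΛ' hfS'] with ω h1 h2
    rw [ENNReal.toReal_add h1.ne h2.ne, neg_add, Real.exp_add]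
  refine h1.trans (((hind.comp (hm hf) (hm hf')).integral_fun_mul_eq_mul_integral
    ((hm hf).comp hΦ.measurable).aestronglyMeasurable
    ((hm hf').comp hΦ'.measurable).aestronglyMeasurable).trans ?_)
  rw [neg_add, Real.exp_add, ← hΦ.integral_exp_neg_lintegral hf hfin hS hSΛ hfS,
    ← hΦ'.integral_exp_neg_lintegral hf' hfin' hS hSΛ' hfS']
  rfl

end IsPoissonProcess

/-! ### Averages over the marks and over the plane -/

/-- The Laplace transform of the normalised Gamma law. The truncation `max h 0` comes from
`ENNReal.ofReal` in the interference and is harmless because the density vanishes for h < 0. -/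
lemma integral_exp_neg_gammaMeasure {N : ℕ} (hN : 0 < N) {k : ℝ} (hk : 0 ≤ k) :
    ∫ h, Real.exp (-(k * max h 0)) ∂(gammaMeasure N N) = ((1 + k / N) ^ N)⁻¹ := by
  have hN' : (0 : ℝ) < N := Nat.cast_pos.2 hN
  have hG := Real.Gamma_pos_of_pos hN'
  have hm : Measurable (gammaPDF N N) := (measurable_gammaPDFReal N N).ennreal_ofReal
  rw [gammaMeasure, integral_withDensity_eq_integral_toReal_smul hm
    (Eventually.of_forall fun _ => ENNReal.ofReal_lt_top)]
  have h1 : ∀ h, (gammaPDF N N h).toReal • Real.exp (-(k * max h 0)) =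
      (Set.Ici (0 : ℝ)).indicator (fun h => (N : ℝ) ^ (N : ℝ) / Real.Gamma N *
        (h ^ ((N : ℝ) - 1) * Real.exp (-((N + k) * h)))) h := by
    intro h
    rw [gammaPDF, ENNReal.toReal_ofReal (gammaPDFReal_nonneg hN' hN' h), gammaPDFReal]
    by_cases hh : 0 ≤ h
    · rw [if_pos hh, Set.indicator_of_mem (Set.mem_Ici.2 hh), max_eq_left hh, smul_eq_mul,
        show -((N + k) * h) = -(N * h) + -(k * h) by ring, Real.exp_add]
      ring
    · rw [if_neg hh, Set.indicator_of_notMem (by simpa using hh), zero_smul]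
  simp_rw [h1]
  rw [integral_indicator measurableSet_Ici, integral_Ici_eq_integral_Ioi,
    integral_const_mul, Real.integral_rpow_mul_exp_neg_mul_Ioi hN' (by positivity),
    Real.rpow_natCast, Real.rpow_natCast]
  have : (1 : ℝ) + k / N = (N + k) / N := by field_simp
  rw [this, div_pow, div_pow, one_pow]
  field_simp

lemma integral_radial (ρ : ℝ) (hρ : 0 ≤ ρ) (f : ℝ → ℝ) {a b : ℝ} (ha : 0 ≤ a) :
    ∫ x : EuclideanSpace ℝ (Fin 2), (Set.Ioc a b).indicator f ‖x‖ ∂(ENNReal.ofReal ρ • volume) =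
      2 * Real.pi * ρ * ∫ v in Set.Ioc a b, v * f v := by
  rw [integral_smul_measure, integral_fun_norm_addHaar, ENNReal.toReal_ofReal hρ,
    finrank_euclideanSpace_fin]
  have hball : (volume : Measure (EuclideanSpace ℝ (Fin 2))).real (Metric.ball 0 1) = Real.pi := by
    rw [measureReal_def, EuclideanSpace.volume_ball_fin_two]
    simp [Real.pi_pos.le]
  have h1 : ∀ v : ℝ, v ^ (2 - 1) • (Set.Ioc a b).indicator f v =
      (Set.Ioc a b).indicator (fun v => v * f v) v := by
    intro v
    by_cases hv : v ∈ Set.Ioc a b <;> simp [hv]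
  simp_rw [h1]
  have hsub : Set.Ioc a b ⊆ Set.Ioi 0 := fun v hv => ha.trans_lt hv.1
  rw [setIntegral_indicator measurableSet_Ioc, hball, Set.inter_eq_right.2 hsub]
  simp only [nsmul_eq_mul, smul_eq_mul]
  push_cast
  ring

lemma integral_cond_Icc {D : ℝ} (hD : 0 < D) (f : ℝ → ℝ) :
    ∫ ω, f ω ∂(ProbabilityTheory.cond volume (Set.Icc (-D) D)) = (∫ x in (-1 : ℝ)..1, f (x * D)) / 2 := by
  rw [ProbabilityTheory.cond, integral_smul_measure, Real.volume_Icc, integral_Icc_eq_integral_Ioc,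
    ← intervalIntegral.integral_of_le (by linarith), intervalIntegral.integral_comp_mul_right _ hD.ne']
  rw [ENNReal.toReal_inv, ENNReal.toReal_ofReal (by linarith)]
  simp only [smul_eq_mul, neg_mul, one_mul]
  field_simp
  ring

namespace PicoTier

variable (T : PicoTier)

/-- Half-width of the interval of angles. -/
def halfWidth : ℝ := T.d / T.wavelength

lemma halfWidth_pos : 0 < T.halfWidth := div_pos T.d_pos T.wavelength_pos

/-- Law of the angle variable. -/
def angleLaw : Measure ℝ := ProbabilityTheory.cond volume (Set.Icc (-(T.d / T.wavelength)) (T.d / T.wavelength))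

instance : IsProbabilityMeasure T.angleLaw := by
  have h := T.halfWidth_pos
  rw [halfWidth] at h
  refine cond_isProbabilityMeasure_of_finite ?_ ?_
  · rw [Real.volume_Icc, ENNReal.ofReal_ne_zero_iff]
    linarith
  · simp

instance : IsProbabilityMeasure (gammaMeasure T.N T.N) :=
  isProbabilityMeasure_gammaMeasure T.N_cast_pos T.N_cast_pos

lemma pathLoss_nonneg {v : ℝ} (hv : 0 ≤ v) : 0 ≤ T.pathLoss v := by
  rw [pathLoss]
  split_ifs
  · exact mul_nonneg T.C_pos.le (Real.rpow_nonneg hv _)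
  · exact le_rfl

lemma measurable_pathLoss : Measurable T.pathLoss := by
  refine Measurable.ite measurableSet_Iic ?_ measurable_const
  fun_prop

lemma measurable_rxPower : Measurable T.rxPower := by
  have h1 := T.measurable_pathLoss
  have h2 := T.continuous_gain.measurable
  unfold rxPower
  fun_prop

/-- `c` times the power received from a base station outside the disc of radius `r`. -/
def exteriorPower (c r : ℝ) (x : MarkedBS) : ℝ≥0∞ :=
  {x : MarkedBS | r < ‖x.1‖}.indicator
    (fun x => ENNReal.ofReal c * ENNReal.ofReal (T.rxPower x)) x

lemma measurableSet_exterior (r : ℝ) : MeasurableSet {x : MarkedBS | r < ‖x.1‖} :=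
  measurableSet_lt measurable_const measurable_fst.norm

lemma measurable_exteriorPower (c r : ℝ) : Measurable (T.exteriorPower c r) :=
  (measurable_const.mul T.measurable_rxPower.ennreal_ofReal).indicator (measurableSet_exterior r)

lemma exteriorPower_ne_top (c r : ℝ) (x : MarkedBS) : T.exteriorPower c r x ≠ ∞ := by
  rw [exteriorPower, Set.indicator]
  split_ifs
  · exact ENNReal.mul_ne_top ENNReal.ofReal_ne_top ENNReal.ofReal_ne_top
  · exact ENNReal.zero_ne_top

/-- The marked base stations within the line-of-sight ball. -/
def losBall : Set MarkedBS := {x | ‖x.1‖ ≤ T.R}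

lemma measurableSet_losBall : MeasurableSet T.losBall :=
  measurableSet_le measurable_fst.norm measurable_const

lemma exteriorPower_eq_zero (c r : ℝ) {x : MarkedBS} (hx : x ∉ T.losBall) :
    T.exteriorPower c r x = 0 := by
  have h : ¬ ‖x.1‖ ≤ T.R := hx
  simp [exteriorPower, Set.indicator, rxPower, pathLoss, h]

lemma markedIntensity_eq (ρ : ℝ) : T.markedIntensity ρ =
    (ENNReal.ofReal ρ • (volume : Measure (EuclideanSpace ℝ (Fin 2)))).prod
      (T.angleLaw.prod (gammaMeasure T.N T.N)) := rfl

lemma markedIntensity_losBall_ne_top (ρ : ℝ) : T.markedIntensity ρ T.losBall ≠ ∞ := by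
  have h : T.losBall = Metric.closedBall (0 : EuclideanSpace ℝ (Fin 2)) T.R ×ˢ Set.univ := by
    ext x
    simp [losBall]
  rw [markedIntensity_eq, h, Measure.prod_prod, measure_univ, mul_one, Measure.smul_apply,
    smul_eq_mul]
  exact ENNReal.mul_ne_top ENNReal.ofReal_ne_top measure_closedBall_lt_top.ne

/-- Scale of the interference exponent at angle `ω`. -/
def angleScale (c ω : ℝ) : ℝ := c * T.power * T.C * T.ants * T.gain ω / T.N

lemma angleScale_nonneg {c : ℝ} (hc : 0 ≤ c) (ω : ℝ) : 0 ≤ T.angleScale c ω := by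
  have := T.power_pos.le
  have := T.C_pos.le
  have := T.gain_nonneg ω
  unfold angleScale
  positivity

lemma continuous_angleScale (c : ℝ) : Continuous (T.angleScale c) := by
  have := T.continuous_gain
  unfold angleScale
  fun_prop

/-- Fading average of the interference exponent, as a function of distance and angle. -/
def fadingAvg (c r ω v : ℝ) : ℝ :=
  (Set.Ioc r T.R).indicator (fun v => 1 - ((1 + T.angleScale c ω * v ^ (-T.α)) ^ T.N)⁻¹) v

lemma integral_fading {c r : ℝ} (hc : 0 ≤ c) (x : EuclideanSpace ℝ (Fin 2)) (ω : ℝ) :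
    ∫ h, (1 - Real.exp (-(T.exteriorPower c r (x, ω, h)).toReal)) ∂(gammaMeasure T.N T.N) =
      T.fadingAvg c r ω ‖x‖ := by
  have hN := T.N_cast_pos
  by_cases hx : ‖x‖ ∈ Set.Ioc r T.R
  · have hk : 0 ≤ T.angleScale c ω * ‖x‖ ^ (-T.α) :=
      mul_nonneg (T.angleScale_nonneg hc ω) (Real.rpow_nonneg (norm_nonneg x) _)
    -- The factor N compensates the division by N in `angleScale`, so that the Gamma average is a
    -- power of 1 + `angleScale` · ‖x‖^(-α).
    have h1 : ∀ h, (T.exteriorPower c r (x, ω, h)).toReal =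
        T.N * (T.angleScale c ω * ‖x‖ ^ (-T.α)) * max h 0 := by
      intro h
      have hnn : 0 ≤ T.power * T.pathLoss ‖x‖ * (T.ants * T.gain ω) :=
        mul_nonneg (mul_nonneg T.power_pos.le (T.pathLoss_nonneg (norm_nonneg x)))
          (mul_nonneg (Nat.cast_nonneg _) (T.gain_nonneg ω))
      have h2 : T.rxPower (x, ω, h) = T.power * T.pathLoss ‖x‖ * (T.ants * T.gain ω) * h := by
        simp only [rxPower]
        ring
      have hmem : (x, ω, h) ∈ {x : MarkedBS | r < ‖x.1‖} := hx.1
      rw [exteriorPower, Set.indicator_of_mem hmem, ENNReal.toReal_mul,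
        ENNReal.toReal_ofReal hc, h2, ENNReal.toReal_ofReal', ← mul_zero
        (T.power * T.pathLoss ‖x‖ * (T.ants * T.gain ω)), ← mul_max_of_nonneg _ _ hnn, pathLoss,
        if_pos hx.2, angleScale, mul_zero]
      field_simp
    have hint : Integrable (fun h => Real.exp (-(T.N * (T.angleScale c ω * ‖x‖ ^ (-T.α)) *
        max h 0))) (gammaMeasure T.N T.N) := by
      refine Integrable.of_bound (by fun_prop) 1 (Eventually.of_forall fun h => ?_)
      rw [Real.norm_of_nonneg (Real.exp_pos _).le, Real.exp_le_one_iff, neg_nonpos]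
      exact mul_nonneg (mul_nonneg hN.le hk) (le_max_right _ _)
    simp_rw [h1]
    rw [integral_sub (integrable_const _) hint,
      integral_exp_neg_gammaMeasure T.N_pos (mul_nonneg hN.le hk), fadingAvg,
      Set.indicator_of_mem hx, mul_div_cancel_left₀ _ hN.ne']
    simp
  · have h1 : ∀ h, T.exteriorPower c r (x, ω, h) = 0 := by
      intro h
      by_cases hr : r < ‖x‖
      · exact T.exteriorPower_eq_zero c r fun hR => hx ⟨hr, hR⟩
      · simp [exteriorPower, hr]
    simp [h1, fadingAvg, hx]

/-- Density of the interference exponent with respect to the angle law. -/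
def angleExponent (ρ c r ω : ℝ) : ℝ :=
  Real.pi * ρ * (T.R ^ 2 * (1 + T.discKernel (T.angleScale c ω / T.R ^ T.α)) -
    r ^ 2 * (1 + T.discKernel (T.angleScale c ω / r ^ T.α)))

/-- The annulus is the disc of radius R minus the disc of radius r, and each disc is given by
`integral_disc`. -/
lemma integral_fadingAvg {c r ρ : ℝ} (hc : 0 ≤ c) (hρ : 0 ≤ ρ) (hr : 0 ≤ r) (hrR : r ≤ T.R)
    (ω : ℝ) : ∫ x : EuclideanSpace ℝ (Fin 2), T.fadingAvg c r ω ‖x‖ ∂(ENNReal.ofReal ρ • volume) =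
      T.angleExponent ρ c r ω := by
  have hX := T.angleScale_nonneg hc ω
  obtain ⟨i1, e1⟩ := T.integral_disc hX hr
  obtain ⟨i2, e2⟩ := T.integral_disc hX T.R_pos.le
  simp only [fadingAvg]
  rw [integral_radial ρ hρ _ hr]
  have h := setIntegral_union (Set.Ioc_disjoint_Ioc_of_le le_rfl) measurableSet_Ioc i1
    (i2.mono_set (Set.Ioc_subset_Ioc_left hr) :
      IntegrableOn (fun v => v * (1 - ((1 + T.angleScale c ω * v ^ (-T.α)) ^ T.N)⁻¹))
        (Set.Ioc r T.R))
  rw [Set.Ioc_union_Ioc_eq_Ioc hr hrR, e1, e2] at h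
  rw [angleExponent]
  linear_combination (-2 * Real.pi * ρ) * h

lemma abs_fadingAvg_le {c r : ℝ} (hc : 0 ≤ c) (hr : 0 ≤ r) (ω v : ℝ) : |T.fadingAvg c r ω v| ≤ 1 := by
  by_cases hv : v ∈ Set.Ioc r T.R
  · have h1 : 0 ≤ T.angleScale c ω * v ^ (-T.α) :=
      mul_nonneg (T.angleScale_nonneg hc ω) (Real.rpow_nonneg (hr.trans hv.1.le) _)
    have h2 : ((1 + T.angleScale c ω * v ^ (-T.α)) ^ T.N)⁻¹ ≤ 1 :=
      inv_le_one_of_one_le₀ (one_le_pow₀ (by linarith))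
    have h3 : 0 < ((1 + T.angleScale c ω * v ^ (-T.α)) ^ T.N)⁻¹ := by positivity
    rw [fadingAvg, Set.indicator_of_mem hv, abs_le]
    constructor <;> linarith
  · simp [fadingAvg, hv]

lemma measurable_fadingAvg (c r : ℝ) : Measurable fun q : EuclideanSpace ℝ (Fin 2) × ℝ =>
    T.fadingAvg c r q.2 ‖q.1‖ := by
  have h1 := (T.continuous_angleScale c).measurable
  have h2 : MeasurableSet {q : EuclideanSpace ℝ (Fin 2) × ℝ | ‖q.1‖ ∈ Set.Ioc r T.R} :=
    measurable_fst.norm measurableSet_Ioc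
  have h3 : Measurable fun q : EuclideanSpace ℝ (Fin 2) × ℝ =>
      1 - ((1 + T.angleScale c q.2 * ‖q.1‖ ^ (-T.α)) ^ T.N)⁻¹ := by
    fun_prop
  exact h3.indicator h2

lemma integrable_fadingAvg {c r : ℝ} (hc : 0 ≤ c) (hr : 0 ≤ r) (ρ : ℝ) :
    Integrable (fun q : EuclideanSpace ℝ (Fin 2) × ℝ => T.fadingAvg c r q.2 ‖q.1‖)
      ((ENNReal.ofReal ρ • (volume : Measure (EuclideanSpace ℝ (Fin 2)))).prod T.angleLaw) := by
  set s := Metric.closedBall (0 : EuclideanSpace ℝ (Fin 2)) T.R ×ˢ (Set.univ : Set ℝ) with hs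
  have hsm : MeasurableSet s := Metric.isClosed_closedBall.measurableSet.prod MeasurableSet.univ
  have hfin : (ENNReal.ofReal ρ • (volume : Measure (EuclideanSpace ℝ (Fin 2)))).prod
      T.angleLaw s ≠ ∞ := by
    rw [hs, Measure.prod_prod, measure_univ, mul_one, Measure.smul_apply, smul_eq_mul]
    exact ENNReal.mul_ne_top ENNReal.ofReal_ne_top measure_closedBall_lt_top.ne
  refine Integrable.mono' ((integrable_indicator_iff hsm).2 (integrableOn_const (C := (1 : ℝ)) hfin))
    (T.measurable_fadingAvg c r).aestronglyMeasurable (Eventually.of_forall fun q => ?_)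
  by_cases hq : q ∈ s
  · rw [Set.indicator_of_mem hq]
    exact T.abs_fadingAvg_le hc hr _ _
  · have : ¬ ‖q.1‖ ≤ T.R := by simpa [hs] using hq
    simp [fadingAvg, this, hq]

lemma norm_one_sub_exp_neg_le {x : ℝ} (hx : 0 ≤ x) : ‖1 - Real.exp (-x)‖ ≤ 1 := by
  have h1 := Real.exp_pos (-x)
  have h2 : Real.exp (-x) ≤ 1 := Real.exp_le_one_iff.2 (by linarith)
  rw [Real.norm_eq_abs, abs_le]
  constructor <;> linarith

lemma measurable_exponent (c r : ℝ) :
    Measurable fun x => 1 - Real.exp (-(T.exteriorPower c r x).toReal) :=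
  measurable_const.sub (Real.measurable_exp.comp (T.measurable_exteriorPower c r).ennreal_toReal.neg)

/-- Fubini, with fading integrated first, then the plane, and the angle left outermost, since the
angle is the variable later discretised. The integrands are bounded by 1 and supported over the
line-of-sight ball, which has finite intensity. -/
lemma integral_exteriorPower {c r ρ : ℝ} (hc : 0 ≤ c) (hρ : 0 ≤ ρ) (hr : 0 ≤ r) (hrR : r ≤ T.R) :
    ∫ x, (1 - Real.exp (-(T.exteriorPower c r x).toReal)) ∂(T.markedIntensity ρ) =
      ∫ ω, T.angleExponent ρ c r ω ∂T.angleLaw := by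
  have hint : Integrable (fun x => 1 - Real.exp (-(T.exteriorPower c r x).toReal))
      (T.markedIntensity ρ) := by
    refine Integrable.mono' ((integrable_indicator_iff T.measurableSet_losBall).2
      (integrableOn_const (C := (1 : ℝ)) (T.markedIntensity_losBall_ne_top ρ)))
      (T.measurable_exponent c r).aestronglyMeasurable (Eventually.of_forall fun x => ?_)
    by_cases hx : x ∈ T.losBall
    · rw [Set.indicator_of_mem hx]
      exact norm_one_sub_exp_neg_le ENNReal.toReal_nonneg
    · simp [T.exteriorPower_eq_zero c r hx, hx]
  rw [markedIntensity_eq] at hint ⊢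
  rw [integral_prod _ hint]
  have h1 : ∀ x : EuclideanSpace ℝ (Fin 2),
      ∫ y, (1 - Real.exp (-(T.exteriorPower c r (x, y)).toReal))
        ∂(T.angleLaw.prod (gammaMeasure T.N T.N)) = ∫ ω, T.fadingAvg c r ω ‖x‖ ∂T.angleLaw := by
    intro x
    rw [integral_prod]
    · refine integral_congr_ae (Eventually.of_forall fun ω => ?_)
      exact T.integral_fading hc x ω
    · exact Integrable.of_bound ((T.measurable_exponent c r).comp
        measurable_prodMk_left).aestronglyMeasurable 1
        (Eventually.of_forall fun y => norm_one_sub_exp_neg_le ENNReal.toReal_nonneg)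
  simp_rw [h1]
  rw [integral_integral_swap (T.integrable_fadingAvg hc hr ρ)]
  simp_rw [T.integral_fadingAvg hc hρ hr hrR]

/-! ### The Laplace transform of the interference -/

/-- The exact exponent of the Laplace transform of the interference. -/
def laplaceExponent (n : ℕ) (r t : ℝ) : ℝ :=
  Real.pi * T.density * (T.R ^ 2 - T.cacheProb * r ^ 2) +
    Real.pi * T.density / 2 * ∫ x in (-1 : ℝ)..1, T.WK n r (x * T.halfWidth) t

lemma mul_interference {c : ℝ} (hc : 0 ≤ c) (r : ℝ) (m m' : Measure MarkedBS) :
    c * T.interference r m m' =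
      (∫⁻ x, T.exteriorPower c r x ∂m + ∫⁻ x, T.exteriorPower c 0 x ∂m').toReal := by
  have hm : Measurable fun x => ENNReal.ofReal (T.rxPower x) := T.measurable_rxPower.ennreal_ofReal
  have h0 : ∀ x, T.exteriorPower c 0 x = ENNReal.ofReal c * ENNReal.ofReal (T.rxPower x) := by
    intro x
    by_cases hx : 0 < ‖x.1‖
    · exact Set.indicator_of_mem (s := {x : MarkedBS | 0 < ‖x.1‖}) hx _
    -- A station at the origin is missing from the exterior of radius 0, but its power is 0 as well,
    -- since `0 ^ (-α)` is `0` by convention.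
    · have hx0 : ‖x.1‖ = 0 := le_antisymm (not_lt.1 hx) (norm_nonneg _)
      rw [exteriorPower, Set.indicator_of_notMem (s := {x : MarkedBS | 0 < ‖x.1‖}) hx, rxPower,
        pathLoss, hx0, Real.zero_rpow (neg_ne_zero.2 T.α_pos.ne')]
      simp
  have h1 : ∫⁻ x, T.exteriorPower c r x ∂m =
      ENNReal.ofReal c * ∫⁻ x in {x | r < ‖x.1‖}, ENNReal.ofReal (T.rxPower x) ∂m := by
    simp only [exteriorPower]
    rw [lintegral_indicator (measurableSet_exterior r), lintegral_const_mul _ hm]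
  simp_rw [h0]
  rw [h1, lintegral_const_mul _ hm, ← mul_add, ENNReal.toReal_mul, ENNReal.toReal_ofReal hc,
    interference]

lemma integral_angleLaw_add (n : ℕ) (r t : ℝ) {A B : ℝ → ℝ} (hA : Continuous A)
    (hB : Continuous B)
    (hAB : ∀ ω, A ω + B ω = Real.pi * T.density * (T.R ^ 2 - T.cacheProb * r ^ 2) +
      Real.pi * T.density * T.WK n r ω t) :
    ∫ ω, A ω ∂T.angleLaw + ∫ ω, B ω ∂T.angleLaw = T.laplaceExponent n r t := by
  have hWK : Continuous fun x => T.WK n r (x * T.halfWidth) t :=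
    T.continuous_WK n continuous_const (by fun_prop) continuous_const
  have hmul : Continuous fun x : ℝ => x * T.halfWidth := by fun_prop
  have eA : ∫ ω, A ω ∂T.angleLaw = _ := integral_cond_Icc T.halfWidth_pos A
  have eB : ∫ ω, B ω ∂T.angleLaw = _ := integral_cond_Icc T.halfWidth_pos B
  have eAB := intervalIntegral.integral_add (μ := volume) (a := -1) (b := 1)
    ((hA.comp hmul).intervalIntegrable _ _) ((hB.comp hmul).intervalIntegrable _ _)
  simp only [Function.comp, hAB] at eAB
  rw [intervalIntegral.integral_add intervalIntegrable_const
    ((hWK.const_mul _).intervalIntegrable _ _), intervalIntegral.integral_const,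
    intervalIntegral.integral_const_mul, smul_eq_mul] at eAB
  rw [eA, eB, ← add_div, ← eAB, laplaceExponent]
  ring

lemma continuous_angleExponent (ρ c r : ℝ) : Continuous (T.angleExponent ρ c r) := by
  have hK : ∀ y, Continuous fun ω => 1 + T.discKernel (T.angleScale c ω / y) := fun y =>
    continuous_const.add (T.continuous_discKernel.comp ((T.continuous_angleScale c).div_const y))
  exact continuous_const.mul ((continuous_const.mul (hK _)).sub (continuous_const.mul (hK _)))

/-- The caching stations contribute the annulus with weight p and the others the whole disc with
weight 1 - p. In the latter the inner term carries the factor 0², so the quotient by 0^α is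
immaterial. -/
lemma angleExponent_add (n : ℕ) {c r t : ℝ} (hr : 0 < r) {ω : ℝ}
    (hscale : T.angleScale c ω = T.Z n ω * t * r ^ T.α) :
    T.angleExponent (T.cacheProb * T.density) c r ω +
      T.angleExponent ((1 - T.cacheProb) * T.density) c 0 ω =
      Real.pi * T.density * (T.R ^ 2 - T.cacheProb * r ^ 2) +
        Real.pi * T.density * T.WK n r ω t := by
  have hrα := Real.rpow_pos_of_pos hr T.α
  have e : T.Z n ω * t * r ^ T.α / r ^ T.α = T.Z n ω * t := mul_div_cancel_right₀ _ hrα.ne'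
  rw [angleExponent, angleExponent, hscale, e, WK]
  ring

lemma laplace_interference {Ω : Type*} [MeasurableSpace Ω] {μ : Measure Ω} [IsProbabilityMeasure μ]
    {Φ Φ' : Ω → Measure MarkedBS}
    (hΦ : IsPoissonProcess Φ (T.markedIntensity (T.cacheProb * T.density)) μ)
    (hΦ' : IsPoissonProcess Φ' (T.markedIntensity ((1 - T.cacheProb) * T.density)) μ)
    (hindep : IndepFun Φ Φ' μ) (n : ℕ) {r t : ℝ} (hr : 0 < r) (hrR : r ≤ T.R) (ht : 0 ≤ t) :
    ∫ ω, Real.exp (-(n * (T.eta * T.fadingThreshold t r (T.interference r (Φ ω) (Φ' ω))))) ∂μ =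
      Real.exp (-T.laplaceExponent n r t) := by
  have hrα := Real.rpow_pos_of_pos hr T.α
  have hpow := T.power_pos
  have hC := T.C_pos
  have hG := T.G₀_pos
  have hN := T.N_cast_pos
  have hants : (0 : ℝ) < T.ants := Nat.cast_pos.2 T.ants_pos
  -- Chosen so that n η times the fading threshold is c · I; the factor r^α is the inverse path loss
  -- of the serving link.
  set c := n * T.eta * t * r ^ T.α / (T.power * T.C * T.G₀ * T.ants) with hc_def
  have hc : 0 ≤ c := by
    have := T.eta_pos
    positivity
  have h1 : ∀ I, n * (T.eta * T.fadingThreshold t r I) = c * I := by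
    intro I
    rw [fadingThreshold, pathLoss, if_pos hrR, hc_def, Real.rpow_neg hr.le]
    field_simp
  have hscale : ∀ ω, T.angleScale c ω = T.Z n ω * t * r ^ T.α := by
    intro ω
    rw [angleScale, hc_def, Z]
    field_simp
  have hp0 := T.cacheProb_nonneg
  have hp1 := T.cacheProb_le_one
  have hl := T.density_pos
  simp_rw [h1, T.mul_interference hc r]
  rw [hΦ.integral_exp_neg_add hΦ' hindep (T.measurable_exteriorPower c r)
    (T.measurable_exteriorPower c 0) (T.exteriorPower_ne_top c r) (T.exteriorPower_ne_top c 0)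
    T.measurableSet_losBall (T.markedIntensity_losBall_ne_top _)
    (T.markedIntensity_losBall_ne_top _) (fun x hx => T.exteriorPower_eq_zero c r hx)
    (fun x hx => T.exteriorPower_eq_zero c 0 hx),
    T.integral_exteriorPower hc (mul_nonneg hp0 hl.le) hr.le hrR,
    T.integral_exteriorPower hc (mul_nonneg (by linarith) hl.le) le_rfl T.R_pos.le,
    T.integral_angleLaw_add n r t (T.continuous_angleExponent _ c r)
      (T.continuous_angleExponent _ c 0) fun ω => T.angleExponent_add n hr (hscale ω)]

end PicoTier

/-! ### Interior nodes, termwise derivatives and quadrature with a moving parameter. -/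

lemma neg_one_lt_chebNode {u k : ℕ} (hk : k ∈ Finset.Icc 1 u) : -1 < chebNode u k := by
  rw [Finset.mem_Icc] at hk
  have h1 : (1 : ℝ) ≤ k := Nat.one_le_cast.2 hk.1
  have h2 : (k : ℝ) ≤ u := Nat.cast_le.2 hk.2
  have hπ := Real.pi_pos
  rw [chebNode, ← Real.cos_pi]
  refine Real.cos_lt_cos_of_nonneg_of_le_pi (mul_nonneg ?_ hπ.le) le_rfl ?_
  · exact div_nonneg (by linarith) (by linarith)
  · refine mul_lt_of_lt_one_left hπ ?_
    rw [div_lt_one (by linarith)]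
    linarith

lemma hasDerivAt_chebQuad {u : ℕ} {F : ℝ → ℝ → ℝ} {F' : ℝ → ℝ} {τ : ℝ}
    (h : ∀ k ∈ Finset.Icc 1 u,
      HasDerivAt (fun t => F t (chebNode u k)) (F' (chebNode u k)) τ) :
    HasDerivAt (fun t => chebQuad u (F t)) (chebQuad u F') τ := by
  unfold chebQuad
  exact (HasDerivAt.fun_sum fun k hk => (h k hk).mul_const _).const_mul _

lemma chebQuad_neg (u : ℕ) (f : ℝ → ℝ) : chebQuad u (fun x => -f x) = -chebQuad u f := by
  simp [chebQuad, Finset.sum_neg_distrib]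

/-- `tendsto_chebQuad` is applied with index filter l ×ˢ 𝓝 y, so the parameter moves together with
the order. The result is continuous convergence in y, the hypothesis needed for an outer quadrature.
-/
lemma tendsto_chebQuad_param {f : ℝ → ℝ → ℝ} (hf : Continuous fun q : ℝ × ℝ => f q.1 q.2)
    {ι : Type*} {l : Filter ι} {u : ι → ℕ} (hu : Tendsto u l atTop) (y : ℝ) :
    Tendsto (fun q : ι × ℝ => chebQuad (u q.1) (f q.2)) (l ×ˢ 𝓝 y)
      (𝓝 (∫ x in (-1 : ℝ)..1, f y x)) := by
  have hfy : Continuous (f y) := by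
    have h : Continuous fun x : ℝ => (y, x) := by fun_prop
    simpa only [Function.comp_def] using hf.comp h
  refine tendsto_chebQuad (F := fun q : ι × ℝ => f q.2) hfy (fun x => ?_)
    (hu.comp tendsto_fst)
  have h1 : Tendsto (fun q : (ι × ℝ) × ℝ => (q.1.2, q.2)) ((l ×ˢ 𝓝 y) ×ˢ 𝓝 x) (𝓝 (y, x)) :=
    (tendsto_snd.comp tendsto_fst).prodMk_nhds tendsto_snd
  exact (hf.tendsto (y, x)).comp h1

namespace PicoTier

variable (T : PicoTier)

/-- Binomial theorem; the leading 1 cancels the term n = 0. -/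
lemma fadingTail_eq (γ : ℝ) : T.fadingTail γ = ∑ n ∈ Finset.Icc 1 T.N,
    (-1) ^ (n + 1) * (T.N.choose n : ℝ) * Real.exp (-(n * (T.eta * γ))) := by
  have h := add_pow (-Real.exp (-(T.eta * γ))) 1 T.N
  rw [Finset.sum_range_succ', Finset.range_eq_Ico,
    Finset.sum_Ico_add' (fun k => (-Real.exp (-(T.eta * γ))) ^ k * 1 ^ (T.N - k) *
      (T.N.choose k : ℝ)) 0 T.N 1] at h
  have hI : Finset.Ico (0 + 1) (T.N + 1) = Finset.Icc 1 T.N := by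
    ext k
    simp only [Finset.mem_Ico, Finset.mem_Icc]
    omega
  rw [hI] at h
  rw [fadingTail, show 1 - Real.exp (-(T.eta * γ)) = -Real.exp (-(T.eta * γ)) + 1 by ring, h]
  simp only [pow_zero, one_pow, Nat.choose_zero_right, Nat.cast_one, mul_one]
  rw [sub_add_cancel_right, ← Finset.sum_neg_distrib]
  refine Finset.sum_congr rfl fun n _ => ?_
  rw [show -(n * (T.eta * γ)) = n * -(T.eta * γ) by ring, Real.exp_nat_mul, neg_pow, pow_succ]
  ring

/-- The serving distance at the quadrature abscissa `x`. -/
def nodeDist (x : ℝ) : ℝ := (x + 1) * T.R / 2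

lemma continuous_nodeDist : Continuous T.nodeDist := by
  unfold nodeDist
  fun_prop

/-- The nodes avoid the endpoint -1, so the quadrature never evaluates at r = 0, where the closed
forms divide by r^α. -/
lemma nodeDist_pos {u k : ℕ} (hk : k ∈ Finset.Icc 1 u) : 0 < T.nodeDist (chebNode u k) := by
  have h1 := neg_one_lt_chebNode hk
  have h2 := T.R_pos
  have h3 : 0 < chebNode u k + 1 := by linarith
  unfold nodeDist
  positivity

lemma integral_nodeDist (g : ℝ → ℝ) :
    T.R / 2 * ∫ x in (-1 : ℝ)..1, g (T.nodeDist x) = ∫ r in (0 : ℝ)..T.R, g r := by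
  have hR := T.R_pos
  have h := intervalIntegral.integral_comp_mul_add (a := -1) (b := 1) g
    (c := T.R / 2) (by positivity) (T.R / 2)
  have e : ∀ x, T.R / 2 * x + T.R / 2 = T.nodeDist x := fun x => by
    unfold nodeDist
    ring
  simp only [e] at h
  rw [h, show T.nodeDist (-1) = 0 by simp [nodeDist], show T.nodeDist 1 = T.R by
    unfold nodeDist
    ring, smul_eq_mul]
  field_simp

lemma continuous_distPDF : Continuous T.distPDF := by
  unfold distPDF
  fun_prop

/-! ### The coverage probability and its derivative -/

/-- `t` times the `t`-derivative of the exponent of the Laplace transform. -/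
def exponentRate (n : ℕ) (r t : ℝ) : ℝ :=
  Real.pi * T.density / 2 * ∫ x in (-1 : ℝ)..1, T.wK n r (x * T.halfWidth) t

lemma continuous_laplaceExponent {X : Type*} [TopologicalSpace X] (n : ℕ) {r t : X → ℝ}
    (hr : Continuous r) (ht : Continuous t) :
    Continuous fun x => T.laplaceExponent n (r x) (t x) := by
  have h : Continuous fun y => ∫ x in (-1 : ℝ)..1, T.WK n (r y) (x * T.halfWidth) (t y) :=
    continuous_intervalIntegral (f := fun y x => T.WK n (r y) (x * T.halfWidth) (t y))
      (T.continuous_WK n (hr.comp continuous_fst) (by fun_prop) (ht.comp continuous_fst)) _ _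
  unfold laplaceExponent
  fun_prop

lemma continuous_exponentRate {X : Type*} [TopologicalSpace X] (n : ℕ) {r t : X → ℝ}
    (hr : Continuous r) (ht : Continuous t) :
    Continuous fun x => T.exponentRate n (r x) (t x) := by
  have h : Continuous fun y => ∫ x in (-1 : ℝ)..1, T.wK n (r y) (x * T.halfWidth) (t y) :=
    continuous_intervalIntegral (f := fun y x => T.wK n (r y) (x * T.halfWidth) (t y))
      (T.continuous_wK n (hr.comp continuous_fst) (by fun_prop) (ht.comp continuous_fst)) _ _
  exact continuous_const.mul h

lemma hasDerivAt_laplaceExponent (n : ℕ) {r t : ℝ} (hr : 0 ≤ r) (ht : 0 < t) :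
    HasDerivAt (fun t => T.laplaceExponent n r t) (T.exponentRate n r t / t) t := by
  have h := hasDerivAt_intervalIntegral_of_continuous (a := -1) (b := 1)
    (f := fun t x => T.WK n r (x * T.halfWidth) t) (g := fun t x => T.wK n r (x * T.halfWidth) t)
    (by norm_num) ht (T.continuous_WK n continuous_const (by fun_prop) continuous_fst)
    (T.continuous_wK n continuous_const (by fun_prop) continuous_fst)
    (fun t ht x _ => T.hasDerivAt_WK n hr ht _)
  have h2 := (h.const_mul (Real.pi * T.density / 2)).const_add
    (Real.pi * T.density * (T.R ^ 2 - T.cacheProb * r ^ 2))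
  rw [← mul_div_assoc] at h2
  exact h2

/-- The coverage integral for the summation index `n`. -/
def coverageTerm (n : ℕ) (t : ℝ) : ℝ :=
  ∫ r in (0 : ℝ)..T.R, Real.exp (-T.laplaceExponent n r t) * T.distPDF r

/-- The density integral for the summation index `n`. -/
def densityTerm (n : ℕ) (t : ℝ) : ℝ :=
  ∫ r in (0 : ℝ)..T.R,
    T.exponentRate n r t / t * (Real.exp (-T.laplaceExponent n r t) * T.distPDF r)

lemma hasDerivAt_coverageTerm (n : ℕ) {τ : ℝ} (hτ : 0 < τ) :
    HasDerivAt (T.coverageTerm n) (-T.densityTerm n τ) τ := by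
  have hE : Continuous fun q : ℝ × ℝ => T.laplaceExponent n q.2 q.1 :=
    T.continuous_laplaceExponent n continuous_snd continuous_fst
  have hV : Continuous fun q : ℝ × ℝ => T.exponentRate n q.2 q.1 :=
    T.continuous_exponentRate n continuous_snd continuous_fst
  have hp := T.continuous_distPDF
  have h := hasDerivAt_intervalIntegral_of_continuous (a := 0) (b := T.R)
    (f := fun t r => Real.exp (-T.laplaceExponent n r t) * T.distPDF r)
    (g := fun t r => -(T.exponentRate n r t * (Real.exp (-T.laplaceExponent n r t) * T.distPDF r)))
    T.R_pos.le hτ (by fun_prop) (by fun_prop) (fun t ht r hr => ?_)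
  · have e : (∫ r in (0 : ℝ)..T.R, -(T.exponentRate n r τ *
        (Real.exp (-T.laplaceExponent n r τ) * T.distPDF r))) / τ = -T.densityTerm n τ := by
      rw [densityTerm, ← intervalIntegral.integral_div, ← intervalIntegral.integral_neg]
      congr 1
      funext r
      ring
    rw [e] at h
    exact h
  · convert! ((T.hasDerivAt_laplaceExponent n hr.1 ht).neg.exp).mul_const (T.distPDF r) using 1
    simp only [Pi.neg_apply]
    ring

lemma coverage_eq {Ω : Type*} [MeasurableSpace Ω] {μ : Measure Ω} [IsProbabilityMeasure μ]
    {Φ Φ' : Ω → Measure MarkedBS}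
    (hΦ : IsPoissonProcess Φ (T.markedIntensity (T.cacheProb * T.density)) μ)
    (hΦ' : IsPoissonProcess Φ' (T.markedIntensity ((1 - T.cacheProb) * T.density)) μ)
    (hindep : IndepFun Φ Φ' μ) {t : ℝ} (ht : 0 ≤ t) :
    T.coverage μ Φ Φ' t =
      ∑ n ∈ Finset.Icc 1 T.N, (-1) ^ (n + 1) * (T.N.choose n : ℝ) * T.coverageTerm n t := by
  have hcont : ∀ n, Continuous fun r => Real.exp (-T.laplaceExponent n r t) * T.distPDF r := by
    intro n
    have hE : Continuous fun r : ℝ => T.laplaceExponent n r t :=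
      T.continuous_laplaceExponent n continuous_id continuous_const
    have hp := T.continuous_distPDF
    fun_prop
  have h1 : T.coverage μ Φ Φ' t = ∫ r in (0 : ℝ)..T.R, ∑ n ∈ Finset.Icc 1 T.N,
      (-1) ^ (n + 1) * (T.N.choose n : ℝ) *
        (Real.exp (-T.laplaceExponent n r t) * T.distPDF r) := by
    refine intervalIntegral.integral_congr_ae (Eventually.of_forall fun r hr => ?_)
    rw [Set.uIoc_of_le T.R_pos.le] at hr
    have hL := fun n => T.laplace_interference hΦ hΦ' hindep n hr.1 hr.2 ht
    have hi : ∀ n : ℕ, Integrable (fun ω => Real.exp (-(n * (T.eta *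
        T.fadingThreshold t r (T.interference r (Φ ω) (Φ' ω)))))) μ := by
      -- Integrability is read off from the transform: a non-integrable function would have integral
      -- 0, which no exponential equals.
      intro n
      by_contra hcon
      have := hL n
      rw [integral_undef hcon] at this
      exact (Real.exp_pos _).ne this
    simp only [fadingTail_eq]
    rw [integral_finsetSum _ fun n _ => (hi n).const_mul _, Finset.sum_mul]
    refine Finset.sum_congr rfl fun n _ => ?_
    rw [integral_const_mul, hL n, mul_assoc]
  rw [h1, intervalIntegral.integral_finsetSum fun n _ =>
    ((hcont n).const_mul _).intervalIntegrable _ _]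
  refine Finset.sum_congr rfl fun n _ => ?_
  rw [intervalIntegral.integral_const_mul, coverageTerm]

/-! ### The quadrature formulas -/

/-- The exponent of `laplaceGC` at `s = n η r^α / G₀`. -/
def quadExponent (u n : ℕ) (r t : ℝ) : ℝ :=
  Real.pi * T.density * (T.R ^ 2 - T.cacheProb * r ^ 2) +
    Real.pi * T.density / 2 * chebQuad u fun x => T.WK n r (x * T.halfWidth) t

/-- The `t`-derivative of `quadExponent`. -/
def quadRate (u n : ℕ) (r t : ℝ) : ℝ :=
  Real.pi * T.density / 2 * chebQuad u fun x => T.wK n r (x * T.halfWidth) t / t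

lemma hasDerivAt_quadExponent (u n : ℕ) {r t : ℝ} (hr : 0 ≤ r) (ht : 0 < t) :
    HasDerivAt (fun t => T.quadExponent u n r t) (T.quadRate u n r t) t :=
  ((hasDerivAt_chebQuad (F := fun t x => T.WK n r (x * T.halfWidth) t)
    fun _ _ => T.hasDerivAt_WK n hr ht _).const_mul _).const_add _

lemma FD_eq (u n : ℕ) {r t : ℝ} (hr : 0 < r) (ht : 0 < t) :
    T.FD u n r t = Real.exp (-T.quadExponent u n r t) * T.distPDF r := by
  rw [FD, laplaceGC, quadExponent, chebQuad]
  simp only [T.W_eq n hr ht]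
  simp only [mul_div_assoc]
  congr 2
  rw [halfWidth]
  ring

lemma fD_eq (u₁ u₂ n : ℕ) {r t : ℝ} (hr : 0 < r) (ht : 0 < t) : T.fD u₁ u₂ n r t =
    T.quadRate u₂ n r t * (Real.exp (-T.quadExponent u₁ n r t) * T.distPDF r) := by
  rw [fD, T.FD_eq u₁ n hr ht, quadRate, chebQuad]
  simp only [T.w_eq n hr ht, mul_div_assoc]
  rw [halfWidth]
  ring

lemma coverageGC_eq (u v : ℕ) {t : ℝ} (ht : 0 < t) : T.coverageGC u v t =
    ∑ n ∈ Finset.Icc 1 T.N, (-1) ^ (n + 1) * (T.N.choose n : ℝ) * (T.R / 2 * chebQuad v fun x =>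
      Real.exp (-T.quadExponent u n (T.nodeDist x) t) * T.distPDF (T.nodeDist x)) := by
  rw [coverageGC, Finset.mul_sum]
  refine Finset.sum_congr rfl fun n _ => ?_
  have h : ∑ k ∈ Finset.Icc 1 v, T.FD u n ((chebNode v k + 1) * T.R / 2) t *
        Real.sqrt (1 - chebNode v k ^ 2) = ∑ k ∈ Finset.Icc 1 v,
      (Real.exp (-T.quadExponent u n (T.nodeDist (chebNode v k)) t) *
        T.distPDF (T.nodeDist (chebNode v k))) * Real.sqrt (1 - chebNode v k ^ 2) :=
    Finset.sum_congr rfl fun k hk => by rw [← T.FD_eq u n (T.nodeDist_pos hk) ht, nodeDist]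
  rw [h, chebQuad]
  ring

lemma pdfGC_eq (u₁ u₂ u₃ : ℕ) {t : ℝ} (ht : 0 < t) : T.pdfGC u₁ u₂ u₃ t =
    ∑ n ∈ Finset.Icc 1 T.N, (-1) ^ (n + 1) * (T.N.choose n : ℝ) * (T.R / 2 * chebQuad u₃ fun x =>
      T.quadRate u₂ n (T.nodeDist x) t *
        (Real.exp (-T.quadExponent u₁ n (T.nodeDist x) t) * T.distPDF (T.nodeDist x))) := by
  rw [pdfGC, Finset.mul_sum]
  refine Finset.sum_congr rfl fun n _ => ?_
  have h : ∑ k ∈ Finset.Icc 1 u₃, T.fD u₁ u₂ n (T.R * (chebNode u₃ k + 1) / 2) t *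
        Real.sqrt (1 - chebNode u₃ k ^ 2) = ∑ k ∈ Finset.Icc 1 u₃,
      (T.quadRate u₂ n (T.nodeDist (chebNode u₃ k)) t *
        (Real.exp (-T.quadExponent u₁ n (T.nodeDist (chebNode u₃ k)) t) *
        T.distPDF (T.nodeDist (chebNode u₃ k)))) * Real.sqrt (1 - chebNode u₃ k ^ 2) :=
    Finset.sum_congr rfl fun k hk => by
      rw [← T.fD_eq u₁ u₂ n (T.nodeDist_pos hk) ht, nodeDist, mul_comm T.R]
  rw [h, chebQuad]
  ring

/-- With equal inner orders, `quadRate` is the derivative of the very exponent that `FD` contains,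
so the chain rule gives an exact identity. The closed forms agree with the kernel forms only for t >
0, hence the passage to a neighbourhood of τ. -/
lemma hasDerivAt_coverageGC (u v : ℕ) {τ : ℝ} (hτ : 0 < τ) :
    HasDerivAt (fun t => T.coverageGC u v t) (-T.pdfGC u u v τ) τ := by
  have he : (fun t => T.coverageGC u v t) =ᶠ[𝓝 τ] fun t => ∑ n ∈ Finset.Icc 1 T.N,
      (-1) ^ (n + 1) * (T.N.choose n : ℝ) * (T.R / 2 * chebQuad v fun x =>
        Real.exp (-T.quadExponent u n (T.nodeDist x) t) * T.distPDF (T.nodeDist x)) := by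
    filter_upwards [eventually_gt_nhds hτ] with t ht
    exact T.coverageGC_eq u v ht
  refine HasDerivAt.congr_of_eventuallyEq ?_ he
  rw [T.pdfGC_eq u u v hτ, ← Finset.sum_neg_distrib]
  refine HasDerivAt.fun_sum fun n _ => ?_
  rw [← mul_neg, ← mul_neg, ← chebQuad_neg]
  refine ((hasDerivAt_chebQuad fun k hk => ?_).const_mul _).const_mul _
  have hr := (T.nodeDist_pos hk).le
  convert! ((T.hasDerivAt_quadExponent u n hr hτ).neg.exp).mul_const
    (T.distPDF (T.nodeDist (chebNode v k))) using 1
  simp only [Pi.neg_apply]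
  ring

/-! ### Convergence of the quadrature formulas -/

section Convergence

variable {ι : Type*} {l : Filter ι} {u₁ u₂ u₃ : ι → ℕ}

/-- Joint convergence in the order and the abscissa: the outer nodes change while the inner order
grows, so convergence at each fixed abscissa would not suffice. -/
lemma tendsto_quadExponent (hu : Tendsto u₁ l atTop) (n : ℕ) (t y : ℝ) :
    Tendsto (fun q : ι × ℝ => T.quadExponent (u₁ q.1) n (T.nodeDist q.2) t) (l ×ˢ 𝓝 y)
      (𝓝 (T.laplaceExponent n (T.nodeDist y) t)) := by
  have hd := T.continuous_nodeDist
  have h := tendsto_chebQuad_param (f := fun y x => T.WK n (T.nodeDist y) (x * T.halfWidth) t)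
    (T.continuous_WK n (by fun_prop) (by fun_prop) continuous_const) hu y
  have h1 : Continuous fun y => Real.pi * T.density * (T.R ^ 2 - T.cacheProb * T.nodeDist y ^ 2) := by
    fun_prop
  exact ((h1.tendsto y).comp tendsto_snd).add (h.const_mul _)

lemma tendsto_quadRate (hu : Tendsto u₂ l atTop) (n : ℕ) (t y : ℝ) :
    Tendsto (fun q : ι × ℝ => T.quadRate (u₂ q.1) n (T.nodeDist q.2) t) (l ×ˢ 𝓝 y)
      (𝓝 (T.exponentRate n (T.nodeDist y) t / t)) := by
  have hd := T.continuous_nodeDist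
  have h := tendsto_chebQuad_param (f := fun y x => T.wK n (T.nodeDist y) (x * T.halfWidth) t / t)
    ((T.continuous_wK n (by fun_prop) (by fun_prop) continuous_const).div_const t) hu y
  have h2 := h.const_mul (Real.pi * T.density / 2)
  rw [intervalIntegral.integral_div, ← mul_div_assoc] at h2
  exact h2

lemma tendsto_coverageTerm (h₁ : Tendsto u₁ l atTop) (h₃ : Tendsto u₃ l atTop) (n : ℕ) (t : ℝ) :
    Tendsto (fun i => T.R / 2 * chebQuad (u₃ i) fun x =>
      Real.exp (-T.quadExponent (u₁ i) n (T.nodeDist x) t) * T.distPDF (T.nodeDist x)) l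
      (𝓝 (T.coverageTerm n t)) := by
  have hd := T.continuous_nodeDist
  have hp := T.continuous_distPDF
  have hE : Continuous fun y : ℝ => T.laplaceExponent n (T.nodeDist y) t :=
    T.continuous_laplaceExponent n hd continuous_const
  rw [coverageTerm, ← T.integral_nodeDist]
  refine Tendsto.const_mul _ (tendsto_chebQuad (by fun_prop) (fun y => ?_) h₃)
  exact ((Real.continuous_exp.tendsto _).comp (T.tendsto_quadExponent h₁ n t y).neg).mul
    (((hp.comp hd).tendsto y).comp tendsto_snd)

lemma tendsto_densityTerm (h₁ : Tendsto u₁ l atTop) (h₂ : Tendsto u₂ l atTop)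
    (h₃ : Tendsto u₃ l atTop) (n : ℕ) (t : ℝ) :
    Tendsto (fun i => T.R / 2 * chebQuad (u₃ i) fun x => T.quadRate (u₂ i) n (T.nodeDist x) t *
      (Real.exp (-T.quadExponent (u₁ i) n (T.nodeDist x) t) * T.distPDF (T.nodeDist x))) l
      (𝓝 (T.densityTerm n t)) := by
  have hd := T.continuous_nodeDist
  have hp := T.continuous_distPDF
  have hE : Continuous fun y : ℝ => T.laplaceExponent n (T.nodeDist y) t :=
    T.continuous_laplaceExponent n hd continuous_const
  have hV : Continuous fun y : ℝ => T.exponentRate n (T.nodeDist y) t :=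
    T.continuous_exponentRate n hd continuous_const
  rw [densityTerm, ← T.integral_nodeDist]
  refine Tendsto.const_mul _ (tendsto_chebQuad (by fun_prop) (fun y => ?_) h₃)
  exact (T.tendsto_quadRate h₂ n t y).mul
    (((Real.continuous_exp.tendsto _).comp (T.tendsto_quadExponent h₁ n t y).neg).mul
    (((hp.comp hd).tendsto y).comp tendsto_snd))

end Convergence

end PicoTier

end CacheHetNet

end

/-! ### Assembly of the exact derivative and the joint limit. -/

theorem corollary2 (T : CacheHetNet.PicoTier)
    {Ω : Type*} [MeasurableSpace Ω] (μ : Measure Ω) [IsProbabilityMeasure μ]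
    (Φ Φ' : Ω → Measure CacheHetNet.MarkedBS)
    (hΦ : CacheHetNet.IsPoissonProcess Φ (T.markedIntensity (T.cacheProb * T.density)) μ)
    (hΦ' : CacheHetNet.IsPoissonProcess Φ' (T.markedIntensity ((1 - T.cacheProb) * T.density)) μ)
    (hindep : IndepFun Φ Φ' μ) (τ : ℝ) (hτ : 0 < τ) :
    (∀ u v : ℕ, 0 < u → 0 < v →
      HasDerivAt (fun t => T.coverageGC u v t) (-T.pdfGC u u v τ) τ) ∧
    (∀ ε : ℝ, 0 < ε → ∃ u₀ : ℕ, ∀ u₁ u₂ u₃ : ℕ, u₀ ≤ u₁ → u₀ ≤ u₂ → u₀ ≤ u₃ →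
      |T.coverageGC u₁ u₃ τ - T.coverage μ Φ Φ' τ| < ε ∧
      |T.pdfGC u₁ u₂ u₃ τ - -deriv (T.coverage μ Φ Φ') τ| < ε) ∧
    DifferentiableAt ℝ (T.coverage μ Φ Φ') τ := by
  have hcov : T.coverage μ Φ Φ' =ᶠ[𝓝 τ] fun t => ∑ n ∈ Finset.Icc 1 T.N,
      (-1) ^ (n + 1) * (T.N.choose n : ℝ) * T.coverageTerm n t := by
    filter_upwards [eventually_gt_nhds hτ] with t ht
    exact T.coverage_eq hΦ hΦ' hindep ht.le
  have hder : HasDerivAt (T.coverage μ Φ Φ') (∑ n ∈ Finset.Icc 1 T.N,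
      (-1) ^ (n + 1) * (T.N.choose n : ℝ) * -T.densityTerm n τ) τ :=
    HasDerivAt.congr_of_eventuallyEq
      (HasDerivAt.fun_sum fun n _ => (T.hasDerivAt_coverageTerm n hτ).const_mul _) hcov
  refine ⟨fun u v _ _ => T.hasDerivAt_coverageGC u v hτ, fun ε hε => ?_, hder.differentiableAt⟩
  -- The three orders form one index running along `atTop` on ℕ × ℕ × ℕ, which expresses a joint
  -- limit in any manner; a threshold for the triple yields u₀ as the maximum of its components.
  have t₁ : Tendsto (fun q : ℕ × ℕ × ℕ => q.1) atTop atTop := by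
    rw [← prod_atTop_atTop_eq]
    exact tendsto_fst
  have t₂₃ : Tendsto (fun q : ℕ × ℕ × ℕ => q.2) atTop (atTop ×ˢ atTop) := by
    rw [prod_atTop_atTop_eq, ← prod_atTop_atTop_eq]
    exact tendsto_snd
  have t₂ : Tendsto (fun q : ℕ × ℕ × ℕ => q.2.1) atTop atTop := by
    exact tendsto_fst.comp t₂₃
  have t₃ : Tendsto (fun q : ℕ × ℕ × ℕ => q.2.2) atTop atTop := by
    exact tendsto_snd.comp t₂₃
  have hc : Tendsto (fun q : ℕ × ℕ × ℕ => T.coverageGC q.1 q.2.2 τ) atTop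
      (𝓝 (T.coverage μ Φ Φ' τ)) := by
    rw [hcov.eq_of_nhds]
    simp only [T.coverageGC_eq _ _ hτ]
    exact tendsto_finsetSum _ fun n _ => (T.tendsto_coverageTerm t₁ t₃ n τ).const_mul _
  have hp : Tendsto (fun q : ℕ × ℕ × ℕ => T.pdfGC q.1 q.2.1 q.2.2 τ) atTop
      (𝓝 (-deriv (T.coverage μ Φ Φ') τ)) := by
    rw [hder.deriv, ← Finset.sum_neg_distrib]
    simp only [T.pdfGC_eq _ _ _ hτ, mul_neg, neg_neg]
    exact tendsto_finsetSum _ fun n _ => (T.tendsto_densityTerm t₁ t₂ t₃ n τ).const_mul _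
  obtain ⟨⟨a, b, c⟩, habc⟩ := eventually_atTop.1
    ((Metric.tendsto_nhds.1 hc ε hε).and (Metric.tendsto_nhds.1 hp ε hε))
  refine ⟨max a (max b c), fun u₁ u₂ u₃ h₁ h₂ h₃ => ?_⟩
  have := habc (u₁, u₂, u₃) ⟨(le_max_left _ _).trans h₁,
    ((le_max_left _ _).trans (le_max_right _ _)).trans h₂,
    ((le_max_right _ _).trans (le_max_right _ _)).trans h₃⟩
  simpa only [Real.dist_eq] using this
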